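/- **Setting.** Consider an episodic Markov decision process with horizon $H$, measurable state and action spaces $\mathcal S,\mathcal A$, fixed initial state $s_1$, transition kernels $P_h$ and deterministic measurable rewards $r_h:\mathcal S\times\mathcal A\to[0,1]$, $h\in[H]$, such that $\sum_{h=1}^H r_h(s_h,a_h)\le 1$ along all episodes that can occur (almost surely under every policy). Policies are deterministic: $\pi=(\pi_h)_{h\in[H]}$ with $\pi_h:\mathcal S\to\mathcal A$ measurable. Let $V^\pi_h(s)$ and $Q^\pi_h(s,a)$ be the expected sum of the rewards of steps $h,\dots,H$ under $\pi$ given $s_h=s$, respectively $(s_h,a_h)=(s,a)$; put $V^\star_h=\sup_\pi V^\pi_h$, $Q^\star_h=\sup_\pi Q^\pi_h$, and call $\pi$ $\epsilon$-optimal if $V_1^\pi(s_1)\ge V_1^\star(s_1)-\epsilon$. Let $\mathcal F=\mathcal F_1\times\dots\times\mathcal F_H$, where each $\mathcal F_h$ is a set of measurable functions $\mathcal S\times\mathcal A\to[0,1]$, and set $f_{H+1}=0$ for $f\in\mathcal F$. For each $f\in\mathcal F$ fix a (measurable) greedy policy $\pi_f$, i.e. $\pi_{f,h}(s)\in\mathrm{argmax}_a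 f_h(s,a)$. Assume realizability: $Q^\star_h\in\mathcal F_h$ for all $h\in[H]$. **Complexity measures.** Let $(\mathcal T_hg)(s,a)=r_h(s,a)+\mathbb E_{s'\sim P_h(\cdot\mid s,a)}\max_{a'}g(s',a')$. For a class $\mathcal G$ of functions, a probability measure $\nu$ is $\epsilon$-independent of $\mu_1,\dots,\mu_n$ with respect to $\mathcal G$ if some $g\in\mathcal G$ has $\sqrt{\sum_i(\mathbb E_{\mu_i}g)^2}\le\epsilon$ and $|\mathbb E_\nu g|>\epsilon$. The distributional Eluder dimension $\dim_{\mathrm{DE}}(\mathcal G,\Pi,\epsilon)$ is the length of the longest sequence in $\Pi$ for which there is an $\epsilon'\ge\epsilon$ such that every member is $\epsilon'$-independent of its predecessors. With $\mathcal D_{\mathcal F,h}$ the set of the laws of $(s_h,a_h)$ under the policies $\pi_f$, $f\in\mathcal F$, the Q-type Bellman Eluder dimension is $$\dim_{\mathrm{BE}}(\mathcal F,\mathcal D_{\mathcal F},\epsilon)=\max_{h\in[H]}\dim_{\mathrm{DE}}\big(\{f_h-\mathcal T_hf_{h+1}:f\in\mathcal F\},\mathcal D_{\mathcal F,h},\epsilon\big).$$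 The covering number $\mathcal N(\mathcal F,\rho)$ is the least size of a subset $\mathcal F_o\subseteq\mathcal F$ such that every $f\in\mathcal F$ has some $g\in\mathcal F_o$ with $\max_h\|f_h-g_h\|_\infty\le\rho$. **Algorithm** OLIVE$(\mathcal F,\zeta_{\rm act},\zeta_{\rm elim},n_{\rm act},n_{\rm elim})$. For a set $\mathcal D$ of recorded episodes put $$\hat{\mathcal E}_{\mathcal D}(f,h)=\frac1{|\mathcal D|}\sum_{\mathcal D}\big(f_h(s_h,a_h)-r_h-\max_{a'}f_{h+1}(s_{h+1},a')\big).$$ Start with $\mathcal B^0=\mathcal F$. In phase $k=1,2,\dots$: take $f^k\in\mathrm{argmax}_{f\in\mathcal B^{k-1}}f_1(s_1,\pi_{f,1}(s_1))$ and let $\pi^k=\pi_{f^k}$; execute $\pi^k$ for $n_{\rm act}$ episodes, which form $\mathcal D$; if $\sum_{h}\hat{\mathcal E}_{\mathcal D}(f^k,h)\le H\zeta_{\rm act}$, terminate and output $\pi^k$; otherwise pick any $t$ with $\hat{\mathcal E}_{\mathcal D}(f^k,t)>\zeta_{\rm act}$, execute $\pi^k$ for $n_{\rm elim}$ fresh episodes,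 which form $\mathcal D'$, and let $\mathcal B^k=\{f\in\mathcal B^{k-1}:|\hat{\mathcal E}_{\mathcal D'}(f,t)|\le\zeta_{\rm elim}\}$. Ties and the choice of $t$ may be resolved by any rule depending on the data recorded so far; it is assumed that the maximum defining $f^k$ is attained on every non-empty confidence set which recorded data can produce. **Theorem (OLIVE guarantee, Q-type).** There are absolute constants $c,C>0$ such that the following holds in the above setting. Let $\epsilon,\delta\in(0,1]$, let $d=\dim_{\mathrm{BE}}(\mathcal F,\mathcal D_{\mathcal F},\epsilon/H)$ and $N=\mathcal N\big(\mathcal F,\epsilon/(16H\sqrt d)\big)$ be finite with $d\ge1$, let $\iota=\log\frac{Hd}{\delta\epsilon}$, and suppose $Hd\ge2\delta\epsilon$ (which only excludes cases with $H=d=1$ and $\delta\epsilon>\frac12$). Run OLIVE with $$\zeta_{\rm act}=\frac{2\epsilon}{H},\qquad \zeta_{\rm elim}=\frac{\epsilon}{2H\sqrt d},\qquad n_{\rm act}=\left\lceil\frac{cH^2\iota}{\epsilon^2}\right\rceil,\qquad n_{\rm elim}=\left\lceil\frac{cH^2d\,\log(N)\,\iota}{\epsilon^2}\right\rceil .$$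 Then with probability at least $1-\delta$, OLIVE terminates within $dH+1$ phases, outputs a $4\epsilon$-optimal policy, and executes at most $C\,\dfrac{H^3d^2\log(N)\,\iota}{\epsilon^2}$ episodes in total. -/

import Mathlib

open MeasureTheory ProbabilityTheory
open scoped ENNReal

namespace Olive

/-- An episodic Markov decision process with horizon `H`, fixed initial state, Markov transition
kernels and deterministic rewards.  Steps are numbered `0, …, H - 1`; the data attached to indices
`h ≥ H` never matter. -/
structure Mdp (S A : Type*) [MeasurableSpace S] [MeasurableSpace A] where
  H : ℕ
  init : S
  trans : ℕ → Kernel (S × A) S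
  markov : ∀ h, IsMarkovKernel (trans h)
  reward : ℕ → S × A → ℝ
  measurable_reward : ∀ h, Measurable (reward h)

/-- A deterministic (measurable) policy: one map from states to actions for each step. -/
structure Policy (S A : Type*) [MeasurableSpace S] [MeasurableSpace A] where
  act : ℕ → S → A
  measurable_act : ∀ h, Measurable (act h)

/-- A tuple `f = (f_0, …, f_{H-1})` of candidate `Q`-functions, continued by `f_h = 0` for
`h ≥ H`. -/
abbrev QFun (S A : Type*) := ℕ → S × A → ℝ

/-- The state-action pairs `(s_0, a_0), …, (s_H, a_H)` of an episode.  The state `s_H` is the one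
reached after the last step; the action `a_H` is never used. -/
abbrev Episode (S A : Type*) (H : ℕ) := Fin (H + 1) → S × A

/-- `n` recorded episodes. -/
abbrev Dataset (S A : Type*) (H n : ℕ) := Fin n → Episode S A H

section Dynamics

variable {S A : Type*} [MeasurableSpace S] [MeasurableSpace A]

/-- The law of the state-action pairs at steps `h, h + 1, …, h + n` when the pair at step `h` is
given and the actions from step `h + 1` on are chosen by `π`. -/
noncomputable def Mdp.rollout (M : Mdp S A) (π : Policy S A) :
    (n : ℕ) → (h : ℕ) → Kernel (S × A) (Fin (n + 1) → S × A)
  | 0, _ => Kernel.deterministic (fun x _ => x) (measurable_pi_lambda _ fun _ => measurable_id)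
  | n + 1, h =>
      (Kernel.id ×ₖ
        (M.rollout π n (h + 1) ∘ₖ (M.trans h).map (fun s => (s, π.act (h + 1) s)))).map
        (fun p => (Fin.cons p.1 p.2 : Fin (n + 2) → S × A))

theorem measurable_cons (n : ℕ) : Measurable
    (fun p : (S × A) × (Fin (n + 1) → S × A) => (Fin.cons p.1 p.2 : Fin (n + 2) → S × A)) := by
  refine measurable_pi_lambda _ fun i => ?_
  refine Fin.cases ?_ (fun j => ?_) i
  · simpa using measurable_fst
  · exact (measurable_pi_apply j).comp measurable_snd

instance Mdp.isMarkovKernel_rollout (M : Mdp S A) (π : Policy S A) (n h : ℕ) :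
    IsMarkovKernel (M.rollout π n h) := by
  induction n generalizing h with
  | zero => unfold Mdp.rollout; infer_instance
  | succ n ih =>
    have := M.markov h
    have := ih (h + 1)
    have : IsMarkovKernel ((M.trans h).map (fun s => (s, π.act (h + 1) s))) :=
      Kernel.IsMarkovKernel.map _ (measurable_id.prodMk (π.measurable_act (h + 1)))
    unfold Mdp.rollout
    exact Kernel.IsMarkovKernel.map _ (measurable_cons n)

/-- The law of a full episode under the policy `π`. -/
noncomputable def Mdp.episodeLaw (M : Mdp S A) (π : Policy S A) : Measure (Episode S A M.H) :=
  M.rollout π M.H 0 (M.init, π.act 0 M.init)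

instance Mdp.isProbabilityMeasure_episodeLaw (M : Mdp S A) (π : Policy S A) :
    IsProbabilityMeasure (M.episodeLaw π) := by
  unfold Mdp.episodeLaw; infer_instance

/-- The law of `n` independent episodes under the policy `π`. -/
noncomputable def Mdp.datasetLaw (M : Mdp S A) (π : Policy S A) (n : ℕ) :
    Measure (Dataset S A M.H n) :=
  Measure.pi fun _ => M.episodeLaw π

/-- `Q^π_h(s, a)`: the expected sum of the rewards of steps `h, …, H - 1` given that
`(s_h, a_h) = (s, a)`. -/
noncomputable def Mdp.polQ (M : Mdp S A) (π : Policy S A) (h : ℕ) (x : S × A) : ℝ :=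
  ∫ τ, ∑ i : Fin (M.H - h), M.reward (h + i) (τ i.castSucc) ∂(M.rollout π (M.H - h) h x)

/-- `V^π_h(s)`: the expected sum of the rewards of steps `h, …, H - 1` given that `s_h = s`
(so that `a_h = π_h(s)`). -/
noncomputable def Mdp.polV (M : Mdp S A) (π : Policy S A) (h : ℕ) (s : S) : ℝ :=
  M.polQ π h (s, π.act h s)

/-- `V^⋆_h(s) = sup_π V^π_h(s)`. -/
noncomputable def Mdp.optV (M : Mdp S A) (h : ℕ) (s : S) : ℝ :=
  ⨆ π : Policy S A, M.polV π h s

/-- `Q^⋆_h(s, a) = sup_π Q^π_h(s, a)`. -/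
noncomputable def Mdp.optQ (M : Mdp S A) (h : ℕ) (x : S × A) : ℝ :=
  ⨆ π : Policy S A, M.polQ π h x

/-- `π` is `ε`-optimal from the initial state. -/
def Mdp.IsNearOptimal (M : Mdp S A) (ε : ℝ) (π : Policy S A) : Prop :=
  M.optV 0 M.init - ε ≤ M.polV π 0 M.init

/-- Rewards lie in `[0, 1]`, and the rewards collected along the episodes that can occur (under
any policy) add up to at most `1`. -/
def Mdp.NormalizedReward (M : Mdp S A) : Prop :=
  (∀ h < M.H, ∀ x, 0 ≤ M.reward h x ∧ M.reward h x ≤ 1) ∧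
    ∀ π : Policy S A, ∀ᵐ τ ∂(M.episodeLaw π),
      ∑ h : Fin M.H, M.reward h (τ h.castSucc) ≤ 1

/-- The Bellman optimality operator
`(T_h g)(s, a) = r_h(s, a) + E_{s' ∼ P_h(· | s, a)} max_{a'} g(s', a')`. -/
noncomputable def Mdp.bellman (M : Mdp S A) (h : ℕ) (g : S × A → ℝ) (x : S × A) : ℝ :=
  M.reward h x + ∫ s', ⨆ a', g (s', a') ∂(M.trans h x)

end Dynamics

section FunctionClass

variable {S A : Type*}

/-- The product class `F_0 × ⋯ × F_{H-1}`, with the convention `f_h = 0` for `h ≥ H`. -/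
def prodClass (H : ℕ) (F : ℕ → Set (S × A → ℝ)) : Set (QFun S A) :=
  {f | (∀ h < H, f h ∈ F h) ∧ ∀ h, H ≤ h → f h = 0}

/-- The covering number of a class `V` of tuples under `ρ(f, g) = max_{h < H} ‖f_h - g_h‖_∞`:
the least cardinality of a subset `V₀ ⊆ V` such that every `f ∈ V` has some `g ∈ V₀` with
`ρ(f, g) ≤ r`. -/
noncomputable def coveringNumber (H : ℕ) (V : Set (QFun S A)) (r : ℝ) : ℕ∞ :=
  ⨅ (V₀ : Set (QFun S A)) (_ : V₀ ⊆ V)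
    (_ : ∀ f ∈ V, ∃ g ∈ V₀, ∀ h < H, ∀ x, |f h x - g h x| ≤ r), V₀.encard

end FunctionClass

section EluderDimension

variable {X : Type*} [MeasurableSpace X]

/-- `ν` is `ε`-independent of `μ_0, …, μ_{n-1}` with respect to the function class `G`. -/
def IsIndepOf (G : Set (X → ℝ)) (ε : ℝ) {n : ℕ} (ν : Measure X) (μ : Fin n → Measure X) : Prop :=
  ∃ g ∈ G, √(∑ i, (∫ x, g x ∂(μ i)) ^ 2) ≤ ε ∧ ε < |∫ x, g x ∂ν|

/-- The distributional Eluder dimension: the length of the longest sequence in `D` of which, for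
one common `ε' ≥ ε`, every member is `ε'`-independent of its predecessors. -/
noncomputable def distEluderDim (G : Set (X → ℝ)) (D : Set (Measure X)) (ε : ℝ) : ℕ∞ :=
  ⨆ (n : ℕ) (_ : ∃ ρ : Fin n → Measure X, (∀ i, ρ i ∈ D) ∧
    ∃ ε', ε ≤ ε' ∧ ∀ i : Fin n, IsIndepOf G ε' (ρ i) fun j : Fin i => ρ (j.castLE i.2.le)), (n : ℕ∞)

end EluderDimension

section BellmanEluder

variable {S A : Type*} [MeasurableSpace S] [MeasurableSpace A]

/-- The assignment `f ↦ π_f` picks for each `f` of the class a (measurable) greedy policy,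
`π_{f,h}(s) ∈ argmax_a f_h(s, a)`. -/
def IsGreedy (H : ℕ) (V : Set (QFun S A)) (pol : QFun S A → Policy S A) : Prop :=
  ∀ f ∈ V, ∀ h < H, ∀ s a, f h (s, a) ≤ f h (s, (pol f).act h s)

/-- The Bellman residuals `f_h - T_h f_{h+1}` at step `h`. -/
def Mdp.residuals (M : Mdp S A) (V : Set (QFun S A)) (h : ℕ) : Set (S × A → ℝ) :=
  {g | ∃ f ∈ V, g = fun x => f h x - M.bellman h (f (h + 1)) x}

/-- The laws of `(s_h, a_h)` under the greedy policies of the members of the class. -/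
def Mdp.rollinLaws (M : Mdp S A) (V : Set (QFun S A)) (pol : QFun S A → Policy S A)
    (h : Fin M.H) : Set (Measure (S × A)) :=
  {ρ | ∃ f ∈ V, ρ = (M.episodeLaw (pol f)).map fun τ => τ h.castSucc}

/-- The (Q-type) Bellman Eluder dimension with respect to the roll-in laws of the greedy
policies. -/
noncomputable def Mdp.bellmanEluderDim (M : Mdp S A) (V : Set (QFun S A))
    (pol : QFun S A → Policy S A) (ε : ℝ) : ℕ∞ :=
  ⨆ h : Fin M.H, distEluderDim (M.residuals V h) (M.rollinLaws V pol h) ε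

end BellmanEluder

section Algorithm

variable {S A : Type*} [MeasurableSpace S] [MeasurableSpace A]

/-- The thresholds and sample sizes which are the inputs of the algorithm. -/
structure Params where
  zAct : ℝ
  zElim : ℝ
  nAct : ℕ
  nElim : ℕ

/-- The empirical Bellman error of `f` at step `h`: the average over the recorded episodes of
`f_h(s_h, a_h) - r_h - max_{a'} f_{h+1}(s_{h+1}, a')`. -/
noncomputable def Mdp.empError (M : Mdp S A) (f : QFun S A) {n : ℕ} (D : Dataset S A M.H n)
    (h : Fin M.H) : ℝ :=
  (1 / (n : ℝ)) * ∑ i, (f h (D i h.castSucc) - M.reward h (D i h.castSucc) -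
    ⨆ a', f (h + 1) ((D i h.succ).1, a'))

/-- What a phase that does not terminate leaves behind: the episodes collected to decide on
termination, the step that was picked, and the episodes collected for the elimination. -/
structure PhaseRecord (S A : Type*) (H : ℕ) (p : Params) where
  actData : Dataset S A H p.nAct
  step : Fin H
  elimData : Dataset S A H p.nElim

/-- The confidence set after the phases in `hist`: the members of the class which survive the
elimination of each of them. -/
def Mdp.confSet (M : Mdp S A) (V : Set (QFun S A)) (p : Params)
    (hist : List (PhaseRecord S A M.H p)) : Set (QFun S A) :=
  {f | f ∈ V ∧ ∀ q ∈ hist, |M.empError f q.elimData q.step| ≤ p.zElim}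

/-- How the choices left open by the pseudocode are resolved, depending on everything recorded so
far: which optimistic function is taken, and which step is picked. -/
structure Choices (S A : Type*) (H : ℕ) (p : Params) where
  fn : List (PhaseRecord S A H p) → QFun S A
  step : List (PhaseRecord S A H p) → Dataset S A H p.nAct → Fin H

/-- The choices conform to the pseudocode:
`f^k ∈ argmax_{f ∈ B^{k-1}} f_0(s_0, π_f(s_0))`, and the step picked is one at which the empirical
Bellman error of `f^k` exceeds `zAct`. -/
structure Choices.Valid (M : Mdp S A) (V : Set (QFun S A)) (pol : QFun S A → Policy S A)
    (p : Params) (ch : Choices S A M.H p) : Prop where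
  fn_mem : ∀ hist, (M.confSet V p hist).Nonempty → ch.fn hist ∈ M.confSet V p hist
  fn_max : ∀ hist, ∀ g ∈ M.confSet V p hist,
    g 0 (M.init, (pol g).act 0 M.init) ≤
      ch.fn hist 0 (M.init, (pol (ch.fn hist)).act 0 M.init)
  step_gt : ∀ hist D, (∃ h, p.zAct < M.empError (ch.fn hist) D h) →
    p.zAct < M.empError (ch.fn hist) D (ch.step hist D)

open Classical in
/-- The probability that the algorithm, having gone through the phases in `hist` (latest first),
terminates within at most `m` further phases and that `good π k n` then holds, where `π` is the
output policy, `k` the total number of phases and `n` the total number of episodes executed.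

A phase takes `f` from the confidence set, executes `π_f` for `nAct` episodes `D`, and outputs
`π_f` if the empirical Bellman errors of `f` add up to at most `H * zAct`.  Otherwise it picks a
step, executes `π_f` for `nElim` fresh episodes `D'`, and shrinks the confidence set.  A run whose
confidence set has become empty counts as failed.

The probability is the iterated integral over the successive data, each drawn from its conditional
law given the past.  Should the choices depend on the past in a non-measurable way, then the
integrals are lower integrals (suprema over measurable minorants), so that a lower bound for this
quantity claims the most. -/
noncomputable def Mdp.oliveProbWithin (M : Mdp S A) (V : Set (QFun S A))
    (pol : QFun S A → Policy S A) (p : Params) (ch : Choices S A M.H p)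
    (good : Policy S A → ℕ → ℕ → Prop) : ℕ → List (PhaseRecord S A M.H p) → ℝ≥0∞
  | 0, _ => 0
  | m + 1, hist =>
    if (M.confSet V p hist).Nonempty then
      ∫⁻ D, (if ∑ h, M.empError (ch.fn hist) D h ≤ M.H * p.zAct then
          (if good (pol (ch.fn hist)) (hist.length + 1)
            ((hist.length + 1) * p.nAct + hist.length * p.nElim) then 1 else 0)
        else
          ∫⁻ D', M.oliveProbWithin V pol p ch good m (⟨D, ch.step hist D, D'⟩ :: hist)
            ∂(M.datasetLaw (pol (ch.fn hist)) p.nElim))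
        ∂(M.datasetLaw (pol (ch.fn hist)) p.nAct)
    else 0

/-- The probability that the algorithm, started on the class `V`, terminates and that `good` holds
of the output policy, the number of phases and the number of episodes executed. -/
noncomputable def Mdp.oliveProb (M : Mdp S A) (V : Set (QFun S A))
    (pol : QFun S A → Policy S A) (p : Params) (ch : Choices S A M.H p)
    (good : Policy S A → ℕ → ℕ → Prop) : ℝ≥0∞ :=
  ⨆ m, M.oliveProbWithin V pol p ch good m []

end Algorithm

/-- The logarithmic factor `ι = log (H d / (δ ε))`. -/
noncomputable def logFactor (H d : ℕ) (ε δ : ℝ) : ℝ :=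
  Real.log (H * d / (δ * ε))

/-- `zAct = 2 ε / H`, `zElim = ε / (2 H √d)`, `nAct = c H² ι / ε²` and
`nElim = c H² d log(N) ι / ε²`, with the sample sizes rounded up to integers. -/
noncomputable def params (c : ℝ) (H d N : ℕ) (ε δ : ℝ) : Params where
  zAct := 2 * ε / H
  zElim := ε / (2 * H * √d)
  nAct := ⌈c * H ^ 2 * logFactor H d ε δ / ε ^ 2⌉₊
  nElim := ⌈c * H ^ 2 * d * Real.log N * logFactor H d ε δ / ε ^ 2⌉₊

end Olive

/-! ### Integrals of bounded functions -/

namespace Olive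

/-! The argument combines optimism with the Eluder dimension. By the Bellman equation `M.optQ` has
zero Bellman error under every policy (`IsGreedyPair.bellErr_optQ`), so it survives every
elimination whose data are accurate up to `zElim`. Hence the chosen `f` predicts at least the
optimal value at the initial state. The policy loss decomposition (`IsGreedyPair.sum_bellErr`) says
that this prediction exceeds the value of the greedy policy of `f` by exactly the sum of the Bellman
errors of `f` under that policy. If the run stops, this sum is small and the output is nearly
optimal.

If it does not stop, `f` has Bellman error above `ε / H` at the picked step. But `f` survived, so
under each earlier roll-in law eliminated at that step its error is at most `2 * zElim = ε / (H
√d)`. With at most `d` such laws, the root of the sum of squares is at most `ε / H`, so the new law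
is independent of the old ones. Each step is therefore picked at most `d` times, and at most `d * H`
phases fail to stop (`Mdp.IsGoodHist.length_le`).

Accuracy comes from Hoeffding's inequality and a union bound, over the steps for the termination
test and over a finite cover for the elimination. As the choices may depend non-measurably on the
past, no event is formed on the space of whole runs. Instead `Mdp.pow_le_oliveProbWithin` bounds the
iterated integral from below phase by phase, losing one factor per data set; Bernoulli's inequality
turns the product into `1 - δ`. -/

theorem integrable_of_abs_le {X : Type*} [MeasurableSpace X] {μ : Measure X} [IsFiniteMeasure μ]
    {g : X → ℝ} (hg : Measurable g) {C : ℝ} (hb : ∀ x, |g x| ≤ C) : Integrable g μ :=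
  Integrable.of_bound hg.aestronglyMeasurable C (Filter.Eventually.of_forall hb)

theorem abs_integral_le_of_abs_le {X : Type*} [MeasurableSpace X] {μ : Measure X}
    [IsProbabilityMeasure μ] {g : X → ℝ} {C : ℝ} (hb : ∀ x, |g x| ≤ C) : |∫ x, g x ∂μ| ≤ C := by
  simpa using norm_integral_le_of_norm_le_const (μ := μ) (f := g) (C := C)
    (Filter.Eventually.of_forall hb)

theorem integral_const_add_of_prob {X : Type*} [MeasurableSpace X] {μ : Measure X}
    [IsProbabilityMeasure μ] {g : X → ℝ} (hg : Integrable g μ) (c : ℝ) :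
    ∫ x, (c + g x) ∂μ = c + ∫ x, g x ∂μ := by
  rw [integral_add (integrable_const c) hg]
  simp

/-! ### Integrals along roll-outs -/

section Rollout

variable {S A : Type*} [MeasurableSpace S] [MeasurableSpace A]

theorem measurable_pairing (π : Policy S A) (h : ℕ) : Measurable fun s => (s, π.act h s) :=
  measurable_id.prodMk (π.measurable_act h)

theorem Mdp.integral_rollout_zero (M : Mdp S A) (π : Policy S A) (h : ℕ) (x : S × A)
    {g : (Fin 1 → S × A) → ℝ} (hg : Measurable g) :
    ∫ τ, g τ ∂(M.rollout π 0 h x) = g fun _ => x := by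
  rw [Mdp.rollout, Kernel.deterministic_apply]
  exact integral_dirac' g _ hg.stronglyMeasurable

theorem Mdp.integral_rollout_succ (M : Mdp S A) (π : Policy S A) (n h : ℕ) (x : S × A)
    {g : (Fin (n + 2) → S × A) → ℝ} (hg : Measurable g) {C : ℝ} (hb : ∀ τ, |g τ| ≤ C) :
    ∫ τ, g τ ∂(M.rollout π (n + 1) h x) =
      ∫ s, ∫ τ, g (Fin.cons x τ) ∂(M.rollout π n (h + 1) (s, π.act (h + 1) s))
        ∂(M.trans h x) := by
  have := M.markov h
  have hm := measurable_pairing π (h + 1)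
  have : IsMarkovKernel ((M.trans h).map (fun s => (s, π.act (h + 1) s))) :=
    Kernel.IsMarkovKernel.map _ hm
  have hgc : Measurable fun p : (S × A) × (Fin (n + 1) → S × A) =>
      g (Fin.cons p.1 p.2 : Fin (n + 2) → S × A) := hg.comp (measurable_cons n)
  have hgx : Measurable fun τ : Fin (n + 1) → S × A => g (Fin.cons x τ : Fin (n + 2) → S × A) :=
    hgc.comp measurable_prodMk_left
  rw [Mdp.rollout, Kernel.map_apply _ (measurable_cons n),
    integral_map (measurable_cons n).aemeasurable hg.aestronglyMeasurable, Kernel.prod_apply,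
    Kernel.id_apply, Measure.dirac_prod,
    integral_map measurable_prodMk_left.aemeasurable hgc.aestronglyMeasurable,
    Kernel.integral_comp (integrable_of_abs_le hgx fun τ => hb _), Kernel.map_apply _ hm,
    integral_map hm.aemeasurable]
  exact hgx.stronglyMeasurable.integral_kernel.aestronglyMeasurable

theorem Mdp.integral_rollout_head (M : Mdp S A) (π : Policy S A) (n h : ℕ) (x : S × A)
    {φ : S × A → ℝ} (hφ : Measurable φ) {C : ℝ} (hb : ∀ x, |φ x| ≤ C) :
    ∫ τ, φ (τ 0) ∂(M.rollout π n h x) = φ x := by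
  have hm (n : ℕ) : Measurable fun τ : Fin (n + 1) → S × A => φ (τ 0) :=
    hφ.comp (measurable_pi_apply 0)
  cases n with
  | zero => exact M.integral_rollout_zero π h x (hm 0)
  | succ n =>
    have := M.markov h
    rw [M.integral_rollout_succ π n h x (hm _) fun τ => hb _]
    simp

theorem Mdp.measurable_transInt (M : Mdp S A) (h : ℕ) {ψ : S → ℝ} (hψ : Measurable ψ) :
    Measurable fun x => ∫ s, ψ s ∂(M.trans h x) :=
  hψ.stronglyMeasurable.integral_kernel.measurable

/-- The pair at a step is obtained from the preceding one by a transition followed by the choice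
of the policy. -/
theorem Mdp.integral_rollout_tower (M : Mdp S A) (π : Policy S A) {ψ : S × A → ℝ}
    (hψ : Measurable ψ) {C : ℝ} (hb : ∀ x, |ψ x| ≤ C) (n : ℕ) :
    ∀ (h : ℕ) (x : S × A) (i : Fin n), ∫ τ, ψ (τ i.succ) ∂(M.rollout π n h x) =
      ∫ τ, (∫ s, ψ (s, π.act (h + i + 1) s) ∂(M.trans (h + i) (τ i.castSucc)))
        ∂(M.rollout π n h x) := by
  induction n with
  | zero => exact fun _ _ i => i.elim0
  | succ n ih =>
    intro h x i
    have hM := M.markov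
    have hT : Measurable fun y => ∫ s, ψ (s, π.act (h + i + 1) s) ∂(M.trans (h + i) y) :=
      M.measurable_transInt _ (hψ.comp (measurable_pairing π _))
    have hTb (y) : |∫ s, ψ (s, π.act (h + i + 1) s) ∂(M.trans (h + i) y)| ≤ C :=
      abs_integral_le_of_abs_le fun s => hb _
    rw [M.integral_rollout_succ π n h x (g := fun τ => ψ (τ i.succ))
        (hψ.comp (measurable_pi_apply i.succ)) fun τ => hb _,
      M.integral_rollout_succ π n h x (g := fun τ => ∫ s, ψ (s, π.act (h + i + 1) s)
          ∂(M.trans (h + i) (τ i.castSucc)))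
        (hT.comp (measurable_pi_apply i.castSucc)) fun τ => hTb _]
    -- At the first transition the roll-out restarts at the pair chosen by `π`. Later transitions
    -- belong to the roll-out from `h + 1`, where the induction hypothesis applies.
    induction i using Fin.cases with
    | zero =>
      simp only [Fin.cons_succ, Fin.castSucc_zero, Fin.cons_zero, Fin.val_zero, add_zero,
        integral_const, probReal_univ, one_smul]
      exact integral_congr_ae (.of_forall fun s => M.integral_rollout_head π n _ _ hψ hb)
    | succ j =>
      refine integral_congr_ae (.of_forall fun s => ?_)
      simp only [Fin.cons_succ, Fin.castSucc_succ, Fin.val_succ]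
      rw [ih]
      simp only [add_comm, add_left_comm]

end Rollout

end Olive

/-! ### Function tuples with greedy policies -/

namespace Olive

variable {S A : Type*} [MeasurableSpace S] [MeasurableSpace A]

/-- Rewards lie in `[0, 1]`. -/
def Mdp.UnitReward (M : Mdp S A) : Prop :=
  ∀ h < M.H, ∀ x, 0 ≤ M.reward h x ∧ M.reward h x ≤ 1

/-- A tuple of measurable functions with values in `[0, 1]`, vanishing from step `H` on, together
with a greedy policy for it. -/
structure IsGreedyPair (H : ℕ) (f : QFun S A) (π : Policy S A) : Prop where
  measurable : ∀ h, Measurable (f h)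
  nonneg : ∀ h x, 0 ≤ f h x
  le_one : ∀ h x, f h x ≤ 1
  eq_zero : ∀ h, H ≤ h → f h = 0
  greedy : ∀ h s a, f h (s, a) ≤ f h (s, π.act h s)

namespace IsGreedyPair

variable {H : ℕ} {f : QFun S A} {π : Policy S A}

theorem of_mem {F : ℕ → Set (S × A → ℝ)} {pol : QFun S A → Policy S A}
    (hF : ∀ h < H, ∀ g ∈ F h, Measurable g ∧ ∀ x, 0 ≤ g x ∧ g x ≤ 1)
    (hpol : IsGreedy H (prodClass H F) pol) (hf : f ∈ prodClass H F) :
    IsGreedyPair H f (pol f) := by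
  have key (h : ℕ) : h < H ∨ f h = 0 := (lt_or_ge h H).imp_right (hf.2 h)
  refine ⟨fun h => ?_, fun h x => ?_, fun h x => ?_, hf.2, fun h s a => ?_⟩
  all_goals rcases key h with hh | hh
  · exact (hF h hh _ (hf.1 h hh)).1
  · rw [hh]; exact measurable_zero
  · exact ((hF h hh _ (hf.1 h hh)).2 x).1
  · simp [hh]
  · exact ((hF h hh _ (hf.1 h hh)).2 x).2
  · simp [hh]
  · exact hpol f hf h hh s a
  · simp [hh]

theorem abs_le_one (hf : IsGreedyPair H f π) (h : ℕ) (x : S × A) : |f h x| ≤ 1 :=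
  abs_le.2 ⟨by linarith [hf.nonneg h x], hf.le_one h x⟩

/-- Attainment at the greedy action is what makes the supremum measurable in the state, with no
structure assumed on the action space. -/
theorem iSup_eq (hf : IsGreedyPair H f π) (h : ℕ) (s : S) :
    ⨆ a, f h (s, a) = f h (s, π.act h s) := by
  have : Nonempty A := ⟨π.act h s⟩
  exact le_antisymm (ciSup_le fun a => hf.greedy h s a)
    (le_ciSup (f := fun a => f h (s, a)) ⟨1, by rintro _ ⟨a, rfl⟩; exact hf.le_one h _⟩
      (π.act h s))

theorem measurable_iSup (hf : IsGreedyPair H f π) (h : ℕ) :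
    Measurable fun s => ⨆ a, f h (s, a) := by
  simp only [hf.iSup_eq]
  exact (hf.measurable h).comp (measurable_pairing π h)

theorem abs_iSup_le (hf : IsGreedyPair H f π) (h : ℕ) (s : S) : |⨆ a, f h (s, a)| ≤ 1 := by
  rw [hf.iSup_eq]; exact hf.abs_le_one h _

end IsGreedyPair

/-! ### The Bellman optimality equation -/

theorem Mdp.UnitReward.abs_le_one {M : Mdp S A} (hr : M.UnitReward) {h : ℕ} (hh : h < M.H)
    (x : S × A) : |M.reward h x| ≤ 1 :=
  abs_le.2 ⟨by linarith [hr h hh x], (hr h hh x).2⟩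

theorem Mdp.UnitReward.abs_sum_le {M : Mdp S A} (hr : M.UnitReward) {n h : ℕ}
    (hn : h + n ≤ M.H) (τ : Fin (n + 1) → S × A) :
    |∑ i : Fin n, M.reward (h + i) (τ i.castSucc)| ≤ n := by
  refine (Finset.abs_sum_le_sum_abs _ _).trans ?_
  refine (Finset.sum_le_card_nsmul _ _ 1 fun i _ => hr.abs_le_one (by omega) _).trans ?_
  simp

theorem Mdp.measurable_sum_reward (M : Mdp S A) (n h : ℕ) :
    Measurable fun τ : Fin (n + 1) → S × A => ∑ i : Fin n, M.reward (h + i) (τ i.castSucc) :=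
  Finset.measurable_sum _ fun _ _ => (M.measurable_reward _).comp (measurable_pi_apply _)

theorem Mdp.polQ_eq_integral (M : Mdp S A) (π : Policy S A) {h n : ℕ} (hn : M.H - h = n)
    (x : S × A) : M.polQ π h x =
      ∫ τ, ∑ i : Fin n, M.reward (h + i) (τ i.castSucc) ∂(M.rollout π n h x) := by
  subst hn
  rfl

theorem Mdp.polQ_of_le (M : Mdp S A) (π : Policy S A) {h : ℕ} (hh : M.H ≤ h) (x : S × A) :
    M.polQ π h x = 0 := by
  simp [M.polQ_eq_integral π (show M.H - h = 0 by omega)]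

theorem Mdp.polQ_eq (M : Mdp S A) (hr : M.UnitReward) (π : Policy S A) {h : ℕ} (hh : h < M.H)
    (x : S × A) : M.polQ π h x =
      M.reward h x + ∫ s, M.polQ π (h + 1) (s, π.act (h + 1) s) ∂(M.trans h x) := by
  have := M.markov h
  obtain ⟨n, hn⟩ : ∃ n, M.H - h = n + 1 := ⟨M.H - h - 1, by omega⟩
  have hn' : M.H - (h + 1) = n := by omega
  simp only [M.polQ_eq_integral π hn, M.polQ_eq_integral π hn']
  have hm := M.measurable_sum_reward n (h + 1)
  have hb := hr.abs_sum_le (n := n) (h := h + 1) (by omega)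
  rw [M.integral_rollout_succ π n h x (M.measurable_sum_reward (n + 1) h)
    (hr.abs_sum_le (by omega))]
  have inner (s : S) : ∫ τ, ∑ i : Fin (n + 1), M.reward (h + i)
        ((Fin.cons x τ : Fin (n + 2) → S × A) i.castSucc)
        ∂(M.rollout π n (h + 1) (s, π.act (h + 1) s)) =
      M.reward h x + ∫ τ, ∑ i : Fin n, M.reward (h + 1 + i) (τ i.castSucc)
        ∂(M.rollout π n (h + 1) (s, π.act (h + 1) s)) := by
    rw [← integral_const_add_of_prob (integrable_of_abs_le hm hb)]
    refine integral_congr_ae (.of_forall fun τ => ?_)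
    simp only [Fin.sum_univ_succ, Fin.castSucc_zero, Fin.cons_zero, Fin.val_zero, add_zero,
      Fin.castSucc_succ, Fin.cons_succ, Fin.val_succ, add_comm, add_left_comm]
  simp only [inner]
  rw [integral_const_add_of_prob]
  refine integrable_of_abs_le (C := n) ?_ fun s => abs_integral_le_of_abs_le hb
  exact (hm.stronglyMeasurable.integral_kernel.measurable).comp (measurable_pairing π (h + 1))

theorem Mdp.abs_polQ_le (M : Mdp S A) (hr : M.UnitReward) (π : Policy S A) (h : ℕ) (x : S × A) :
    |M.polQ π h x| ≤ M.H := by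
  rcases lt_or_ge h M.H with hh | hh
  · refine (abs_integral_le_of_abs_le (hr.abs_sum_le (by omega))).trans ?_
    exact_mod_cast Nat.sub_le _ _
  · simp [M.polQ_of_le π hh]

theorem Mdp.polQ_nonneg (M : Mdp S A) (hr : M.UnitReward) (π : Policy S A) (h : ℕ) (x : S × A) :
    0 ≤ M.polQ π h x :=
  integral_nonneg fun _ => Finset.sum_nonneg fun i _ => (hr _ (by omega) _).1

theorem Mdp.polQ_le_optQ (M : Mdp S A) (hr : M.UnitReward) (π : Policy S A) (h : ℕ) (x : S × A) :
    M.polQ π h x ≤ M.optQ h x :=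
  le_ciSup (f := fun π => M.polQ π h x)
    ⟨M.H, by rintro _ ⟨π, rfl⟩; exact (abs_le.1 (M.abs_polQ_le hr π h x)).2⟩ π

theorem Mdp.optQ_of_le (M : Mdp S A) {h : ℕ} (hh : M.H ≤ h) : M.optQ h = 0 := by
  funext x
  simp [Mdp.optQ, M.polQ_of_le _ hh]

/-- Backward induction from the horizon. After one step any competitor is worth at most the optimal
value at the next pair, hence at most the optimal value at the greedy action, and by induction `π`
achieves the latter. The given greedy policy replaces a measurable selection argument. -/
theorem Mdp.polQ_greedy_eq_optQ (M : Mdp S A) (hr : M.UnitReward) {π : Policy S A}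
    (hπ : IsGreedyPair M.H M.optQ π) (h : ℕ) : M.polQ π h = M.optQ h := by
  suffices H : ∀ n h, M.H - h ≤ n → M.polQ π h = M.optQ h from H _ h le_rfl
  intro n
  induction n with
  | zero =>
    intro h hh
    rw [M.optQ_of_le (by omega)]
    exact funext (M.polQ_of_le π (by omega))
  | succ n ih =>
    intro h hn
    rcases lt_or_ge h M.H with hh | hh
    · have := M.markov h
      have : Nonempty (Policy S A) := ⟨π⟩
      refine funext fun x => le_antisymm (M.polQ_le_optQ hr π h x) (ciSup_le fun π' => ?_)
      rw [M.polQ_eq hr π hh, M.polQ_eq hr π' hh, ih (h + 1) (by omega)]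
      refine add_le_add le_rfl (integral_mono_of_nonneg
        (.of_forall fun s => M.polQ_nonneg hr _ _ _) ?_ (.of_forall fun s => ?_))
      · exact integrable_of_abs_le ((hπ.measurable _).comp (measurable_pairing π (h + 1)))
          fun s => hπ.abs_le_one _ _
      · exact (M.polQ_le_optQ hr π' _ _).trans (hπ.greedy _ _ _)
    · rw [M.optQ_of_le hh]
      exact funext (M.polQ_of_le π hh)

theorem Mdp.bellman_optQ (M : Mdp S A) (hr : M.UnitReward) {π : Policy S A}
    (hπ : IsGreedyPair M.H M.optQ π) {h : ℕ} (hh : h < M.H) :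
    M.bellman h (M.optQ (h + 1)) = M.optQ h := by
  funext x
  rw [← M.polQ_greedy_eq_optQ hr hπ h, M.polQ_eq hr π hh, M.polQ_greedy_eq_optQ hr hπ (h + 1)]
  simp only [Mdp.bellman, hπ.iSup_eq]

theorem Mdp.optV_le (M : Mdp S A) (hr : M.UnitReward) {π : Policy S A}
    (hπ : IsGreedyPair M.H M.optQ π) (h : ℕ) (s : S) :
    M.optV h s ≤ M.optQ h (s, π.act h s) :=
  have : Nonempty (Policy S A) := ⟨π⟩
  ciSup_le fun π' => (M.polQ_le_optQ hr π' h _).trans (hπ.greedy h s _)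

/-! ### Bellman errors -/

/-- The summand of the empirical Bellman error. -/
noncomputable def Mdp.tdError (M : Mdp S A) (f : QFun S A) (h : Fin M.H)
    (τ : Episode S A M.H) : ℝ :=
  f h (τ h.castSucc) - M.reward h (τ h.castSucc) - ⨆ a', f (h + 1) ((τ h.succ).1, a')

/-- The average Bellman error of `f` at step `h` when `π` is executed. -/
noncomputable def Mdp.bellErr (M : Mdp S A) (f : QFun S A) (π : Policy S A) (h : Fin M.H) : ℝ :=
  ∫ τ, M.tdError f h τ ∂(M.episodeLaw π)

/-- The law of the state-action pair at step `h` under the policy `π`. -/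
noncomputable def Mdp.rollin (M : Mdp S A) (π : Policy S A) (h : Fin M.H) : Measure (S × A) :=
  (M.episodeLaw π).map fun τ => τ h.castSucc

variable {M : Mdp S A} {f : QFun S A} {π : Policy S A}

theorem IsGreedyPair.measurable_tdError (hf : IsGreedyPair M.H f π) (h : Fin M.H) :
    Measurable (M.tdError f h) :=
  (((hf.measurable h).comp (measurable_pi_apply _)).sub
    ((M.measurable_reward h).comp (measurable_pi_apply _))).sub
    ((hf.measurable_iSup (h + 1)).comp (measurable_fst.comp (measurable_pi_apply _)))

theorem IsGreedyPair.tdError_mem_Icc (hf : IsGreedyPair M.H f π) (hr : M.UnitReward)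
    (h : Fin M.H) (τ : Episode S A M.H) : M.tdError f h τ ∈ Set.Icc (-2 : ℝ) 1 := by
  rw [Mdp.tdError, hf.iSup_eq]
  have h1 := hf.nonneg h (τ h.castSucc)
  have h2 := hf.le_one h (τ h.castSucc)
  have h3 := hr h h.2 (τ h.castSucc)
  have h4 := hf.nonneg (h + 1) ((τ h.succ).1, π.act (h + 1) (τ h.succ).1)
  have h5 := hf.le_one (h + 1) ((τ h.succ).1, π.act (h + 1) (τ h.succ).1)
  constructor <;> linarith

theorem Mdp.integral_episodeLaw_tower (M : Mdp S A) (π : Policy S A) {ψ : S × A → ℝ}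
    (hψ : Measurable ψ) {C : ℝ} (hb : ∀ x, |ψ x| ≤ C) (h : Fin M.H) :
    ∫ τ, ψ (τ h.succ) ∂(M.episodeLaw π) =
      ∫ τ, (∫ s, ψ (s, π.act (h + 1) s) ∂(M.trans h (τ h.castSucc))) ∂(M.episodeLaw π) := by
  have := M.integral_rollout_tower π hψ hb M.H 0 (M.init, π.act 0 M.init) h
  simp only [zero_add] at this
  exact this

theorem IsGreedyPair.integral_tdError (hf : IsGreedyPair M.H f π) (hr : M.UnitReward)
    (h : Fin M.H) (μ : Measure (Episode S A M.H)) [IsProbabilityMeasure μ] :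
    ∫ τ, M.tdError f h τ ∂μ = ∫ τ, f h (τ h.castSucc) ∂μ - ∫ τ, M.reward h (τ h.castSucc) ∂μ -
      ∫ τ, (⨆ a', f (h + 1) ((τ h.succ).1, a')) ∂μ := by
  have i1 : Integrable (fun τ : Episode S A M.H => f h (τ h.castSucc)) μ := integrable_of_abs_le
    ((hf.measurable h).comp (measurable_pi_apply _)) fun τ => hf.abs_le_one _ _
  have i2 : Integrable (fun τ : Episode S A M.H => M.reward h (τ h.castSucc)) μ :=
    integrable_of_abs_le ((M.measurable_reward h).comp (measurable_pi_apply _))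
      fun τ => hr.abs_le_one h.2 _
  have i3 : Integrable (fun τ : Episode S A M.H => ⨆ a', f (h + 1) ((τ h.succ).1, a')) μ :=
    integrable_of_abs_le ((hf.measurable_iSup (h + 1)).comp
      (measurable_fst.comp (measurable_pi_apply _))) fun τ => hf.abs_iSup_le _ _
  simp only [Mdp.tdError]
  exact (integral_sub (i1.sub i2) i3).trans (congrArg (· - _) (integral_sub i1 i2))

/-- Averaging over the next state given the current pair turns reward plus maximum into the Bellman
backup. In this form the error is the integral of a residual against a roll-in law, which is what
the Eluder dimension sees. -/
theorem IsGreedyPair.bellErr_eq (hf : IsGreedyPair M.H f π) (hr : M.UnitReward)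
    (π' : Policy S A) (h : Fin M.H) :
    M.bellErr f π' h = ∫ x, (f h x - M.bellman h (f (h + 1)) x) ∂(M.rollin π' h) := by
  have := M.markov h
  have hT := M.measurable_transInt h (hf.measurable_iSup (h + 1))
  have hTb (x) : |∫ s, (⨆ a, f (h + 1) (s, a)) ∂(M.trans h x)| ≤ 1 :=
    abs_integral_le_of_abs_le (hf.abs_iSup_le (h + 1))
  have hbm : Measurable (M.bellman h (f (h + 1))) := (M.measurable_reward h).add hT
  have hev : Measurable fun τ : Episode S A M.H => τ h.castSucc := measurable_pi_apply _
  have hres : Measurable fun x => f h x - M.bellman h (f (h + 1)) x := (hf.measurable h).sub hbm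
  rw [Mdp.rollin, integral_map hev.aemeasurable hres.aestronglyMeasurable, Mdp.bellErr, hf.integral_tdError hr]
  rw [M.integral_episodeLaw_tower π' (ψ := fun x => ⨆ a, f (h + 1) (x.1, a))
    ((hf.measurable_iSup (h + 1)).comp measurable_fst) (fun x => hf.abs_iSup_le _ _) h]
  have i1 : Integrable (fun τ : Episode S A M.H => f h (τ h.castSucc)) (M.episodeLaw π') :=
    integrable_of_abs_le ((hf.measurable h).comp hev) fun τ => hf.abs_le_one _ _
  have i2 : Integrable (fun τ : Episode S A M.H => M.reward h (τ h.castSucc))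
      (M.episodeLaw π') := integrable_of_abs_le ((M.measurable_reward h).comp hev)
      fun τ => hr.abs_le_one h.2 _
  have i3 : Integrable (fun τ : Episode S A M.H =>
      ∫ s, (⨆ a, f (h + 1) (s, a)) ∂(M.trans h (τ h.castSucc))) (M.episodeLaw π') :=
    integrable_of_abs_le (hT.comp hev) fun τ => hTb _
  rw [← integral_sub i1 i2]
  refine (integral_sub (i1.sub i2) i3).symm.trans (integral_congr_ae (.of_forall fun τ => ?_))
  simp only [Mdp.bellman, Pi.sub_apply]
  ring

/-- The policy loss decomposition. -/
theorem IsGreedyPair.sum_bellErr (hf : IsGreedyPair M.H f π) (hr : M.UnitReward) :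
    ∑ h, M.bellErr f π h = f 0 (M.init, π.act 0 M.init) - M.polV π 0 M.init := by
  -- Since `π` is greedy for `f`, the maximum at the next state has mean `a h.succ`. The errors then
  -- telescope up to the rewards, and the last term vanishes because `f` is zero at the horizon.
  set a : Fin (M.H + 1) → ℝ := fun i => ∫ τ, f i (τ i) ∂(M.episodeLaw π) with ha
  have herr (h : Fin M.H) : M.bellErr f π h =
      a h.castSucc - a h.succ - ∫ τ, M.reward h (τ h.castSucc) ∂(M.episodeLaw π) := by
    rw [Mdp.bellErr, hf.integral_tdError hr,
      M.integral_episodeLaw_tower π (ψ := fun x => ⨆ a, f (h + 1) (x.1, a))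
        ((hf.measurable_iSup (h + 1)).comp measurable_fst) (fun x => hf.abs_iSup_le _ _) h]
    simp only [ha, Fin.val_succ]
    -- That the recorded action is the greedy one is built into the law of the episode, not into
    -- each `τ`; conditioning both integrals on the preceding pair makes them comparable.
    rw [M.integral_episodeLaw_tower π (hf.measurable (h + 1)) (hf.abs_le_one (h + 1)) h]
    simp only [hf.iSup_eq, Fin.val_castSucc]
    ring
  have hval : M.polV π 0 M.init =
      ∑ h : Fin M.H, ∫ τ, M.reward h (τ h.castSucc) ∂(M.episodeLaw π) := by
    rw [← integral_finsetSum]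
    · simp [Mdp.polV, Mdp.polQ, Mdp.episodeLaw]
    · exact fun h _ => integrable_of_abs_le ((M.measurable_reward h).comp (measurable_pi_apply _))
        fun τ => hr.abs_le_one h.2 _
  have h0 : a 0 = f 0 (M.init, π.act 0 M.init) :=
    M.integral_rollout_head π _ _ _ (hf.measurable 0) (hf.abs_le_one 0)
  have hl : a (Fin.last M.H) = 0 := by simp [ha, hf.eq_zero M.H le_rfl]
  have htel := (Fin.sum_univ_castSucc a).symm.trans (Fin.sum_univ_succ a)
  simp only [herr, Finset.sum_sub_distrib, hval]
  linarith

end Olive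

namespace Olive

/-! ### Concentration -/

/-- By Hoeffding's lemma each centred term is sub-Gaussian with parameter `((b - a) / 2) ^ 2`, and
the coordinates are independent under the product measure. -/
theorem measureReal_pi_sum_ge_le {X : Type*} [MeasurableSpace X] {μ : Measure X}
    [IsProbabilityMeasure μ] {g : X → ℝ} (hg : Measurable g) {a b : ℝ}
    (hb : ∀ x, g x ∈ Set.Icc a b) (n : ℕ) {t : ℝ} (ht : 0 ≤ t) :
    (Measure.pi fun _ : Fin n => μ).real {D | t ≤ ∑ i, (g (D i) - ∫ x, g x ∂μ)} ≤
      Real.exp (-t ^ 2 / (2 * (n * ((b - a) / 2) ^ 2))) := by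
  have hsub (i : Fin n) : HasSubgaussianMGF (fun D : Fin n → X => g (D i) - ∫ x, g x ∂μ)
      ((‖b - a‖₊ / 2) ^ 2) (Measure.pi fun _ : Fin n => μ) := by
    have := hasSubgaussianMGF_of_mem_Icc (μ := Measure.pi fun _ : Fin n => μ)
      (X := fun D => g (D i)) (a := a) (b := b)
      (hg.comp (measurable_pi_apply i)).aemeasurable (.of_forall fun D => hb _)
    rwa [integral_comp_eval (μ := fun _ : Fin n => μ) (i := i) hg.aestronglyMeasurable] at this
  have hind : iIndepFun (fun (i : Fin n) (D : Fin n → X) => g (D i) - ∫ x, g x ∂μ)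
      (Measure.pi fun _ : Fin n => μ) :=
    iIndepFun_pi (X := fun _ x => g x - ∫ x, g x ∂μ) fun _ => (hg.sub_const _).aemeasurable
  have := HasSubgaussianMGF.measure_sum_ge_le_of_iIndepFun hind (s := Finset.univ)
    (fun i _ => hsub i) ht
  simpa [div_pow] using this

/-- Hoeffding's inequality for the average of `n` independent samples. -/
theorem measureReal_pi_average_gt_le {X : Type*} [MeasurableSpace X] {μ : Measure X}
    [IsProbabilityMeasure μ] {g : X → ℝ} (hg : Measurable g)
    (hb : ∀ x, g x ∈ Set.Icc (-2 : ℝ) 1) (n : ℕ) {t : ℝ} (ht : 0 ≤ t) :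
    (Measure.pi fun _ : Fin n => μ).real
        {D | t < |1 / (n : ℝ) * ∑ i, g (D i) - ∫ x, g x ∂μ|} ≤
      2 * Real.exp (-(2 * n * t ^ 2 / 9)) := by
  rcases Nat.eq_zero_or_pos n with rfl | hn
  · refine measureReal_le_one.trans ?_
    norm_num
  have hn' : (0 : ℝ) < n := by exact_mod_cast hn
  have h1 := measureReal_pi_sum_ge_le (μ := μ) hg hb n (t := n * t) (by positivity)
  have h2 := measureReal_pi_sum_ge_le (μ := μ) hg.neg (a := -1) (b := 2)
    (fun x => ⟨neg_le_neg (hb x).2, neg_le.1 (hb x).1⟩) n (t := n * t) (by positivity)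
  have hexp : -(n * t) ^ 2 / (2 * (n * ((1 - (-2)) / 2) ^ 2)) = -(2 * n * t ^ 2 / 9) := by
    field_simp; norm_num
  have hexp' : -(n * t) ^ 2 / (2 * (n * ((2 - (-1)) / 2) ^ 2)) = -(2 * n * t ^ 2 / 9) := by
    field_simp; norm_num
  rw [hexp] at h1
  rw [hexp'] at h2
  refine le_trans (measureReal_mono ?_ (by finiteness)) ((measureReal_union_le _ _).trans
    ((add_le_add h1 h2).trans_eq (two_mul _).symm))
  intro D hD
  have hsum : ∑ i, (g (D i) - ∫ x, g x ∂μ) =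
      n * (1 / (n : ℝ) * ∑ i, g (D i) - ∫ x, g x ∂μ) := by
    rw [Finset.sum_sub_distrib]
    field_simp
    simp
  have hneg : ∑ i, ((-g) (D i) - ∫ x, (-g) x ∂μ) = -∑ i, (g (D i) - ∫ x, g x ∂μ) := by
    simp only [Pi.neg_apply, integral_neg, ← Finset.sum_neg_distrib]
    exact Finset.sum_congr rfl fun i _ => by ring
  rcases lt_abs.1 (Set.mem_ofPred.1 hD) with h | h
  · left
    rw [Set.mem_ofPred, hsum]
    exact mul_le_mul_of_nonneg_left h.le hn'.le
  · right
    rw [Set.mem_ofPred, hneg, hsum, ← mul_neg]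
    exact mul_le_mul_of_nonneg_left h.le hn'.le

theorem exists_cover {S A : Type*} {H : ℕ} {V : Set (QFun S A)} {r : ℝ} {N : ℕ}
    (hN : coveringNumber H V r = N) : ∃ V₀ ⊆ V, V₀.encard ≤ N ∧
      ∀ f ∈ V, ∃ g ∈ V₀, ∀ h < H, ∀ x, |f h x - g h x| ≤ r := by
  have hlt : coveringNumber H V r < N + 1 := by
    rw [hN]; exact_mod_cast Nat.lt_succ_self N
  simp only [coveringNumber, iInf_lt_iff] at hlt
  obtain ⟨V₀, h1, h2, h3⟩ := hlt
  exact ⟨V₀, h1, Order.le_of_lt_add_one h3, h2⟩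

variable {S A : Type*} [MeasurableSpace S] [MeasurableSpace A] {M : Mdp S A}

theorem IsGreedyPair.measurable_empError {f : QFun S A} {πf : Policy S A}
    (hf : IsGreedyPair M.H f πf) {n : ℕ} (h : Fin M.H) :
    Measurable fun D : Dataset S A M.H n => M.empError f D h :=
  (Finset.measurable_sum _ fun i _ =>
    (hf.measurable_tdError h).comp (measurable_pi_apply i)).const_mul _

/-- The data whose empirical Bellman errors are accurate for all members of a family. -/
def Mdp.accurate (M : Mdp S A) {ι : Type*} (f : ι → QFun S A) (h : ι → Fin M.H)
    (π : Policy S A) (t : ℝ) (n : ℕ) : Set (Dataset S A M.H n) :=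
  {D | ∀ i, |M.empError (f i) D (h i) - M.bellErr (f i) π (h i)| ≤ t}

theorem measurableSet_accurate {ι : Type*} [Finite ι] {f : ι → QFun S A} {πf : ι → Policy S A}
    (hf : ∀ i, IsGreedyPair M.H (f i) (πf i)) (h : ι → Fin M.H) (π : Policy S A) (t : ℝ)
    (n : ℕ) : MeasurableSet (M.accurate f h π t n) := by
  have : M.accurate f h π t n =
      ⋂ i, {D | |M.empError (f i) D (h i) - M.bellErr (f i) π (h i)| ≤ t} := by
    ext; simp [Mdp.accurate]
  rw [this]
  exact .iInter fun i => measurableSet_le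
    (continuous_abs.measurable.comp (((hf i).measurable_empError (h i)).sub_const _))
    measurable_const

/-- A union bound over the family, which is indexed by the steps in the termination test and by a
finite cover in the elimination. -/
theorem le_datasetLaw_accurate {ι : Type*} [Fintype ι] {f : ι → QFun S A} {πf : ι → Policy S A}
    (hr : M.UnitReward) (hf : ∀ i, IsGreedyPair M.H (f i) (πf i)) (h : ι → Fin M.H)
    (π : Policy S A) {t : ℝ} (ht : 0 ≤ t) (n : ℕ) :
    ENNReal.ofReal (1 - Fintype.card ι * (2 * Real.exp (-(2 * n * t ^ 2 / 9)))) ≤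
      M.datasetLaw π n (M.accurate f h π t n) := by
  have : IsProbabilityMeasure (M.datasetLaw π n) := by unfold Mdp.datasetLaw; infer_instance
  rw [← ofReal_measureReal]
  refine ENNReal.ofReal_le_ofReal ?_
  have hc := probReal_compl_eq_one_sub (μ := M.datasetLaw π n)
    (measurableSet_accurate hf h π t n)
  have hle : (M.datasetLaw π n).real (M.accurate f h π t n)ᶜ ≤
      Fintype.card ι * (2 * Real.exp (-(2 * n * t ^ 2 / 9))) := by
    have hsub : (M.accurate f h π t n)ᶜ =
        ⋃ i, {D | t < |M.empError (f i) D (h i) - M.bellErr (f i) π (h i)|} := by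
      ext; simp [Mdp.accurate]
    rw [hsub]
    refine (measureReal_iUnion_fintype_le _).trans ?_
    refine (Finset.sum_le_card_nsmul _ _ _ fun i _ => measureReal_pi_average_gt_le
      (μ := M.episodeLaw π) ((hf i).measurable_tdError (h i))
      ((hf i).tdError_mem_Icc hr (h i)) n ht).trans ?_
    simp
  linarith

/-! ### Covering -/

section Close

variable {f g : QFun S A} {πf πg : Policy S A} {ρ : ℝ}

theorem IsGreedyPair.abs_tdError_sub_le (hf : IsGreedyPair M.H f πf)
    (hg : IsGreedyPair M.H g πg) (hρ : 0 ≤ ρ) (hfg : ∀ h < M.H, ∀ x, |f h x - g h x| ≤ ρ)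
    (h : Fin M.H) (τ : Episode S A M.H) : |M.tdError f h τ - M.tdError g h τ| ≤ 2 * ρ := by
  have hfg' (h : ℕ) (x : S × A) : |f h x - g h x| ≤ ρ := by
    rcases lt_or_ge h M.H with hh | hh
    · exact hfg h hh x
    · simpa [hf.eq_zero h hh, hg.eq_zero h hh] using hρ
  simp only [Mdp.tdError, hf.iSup_eq, hg.iSup_eq]
  have h1 := abs_le.1 (hfg' h (τ h.castSucc))
  -- The two maxima differ by at most `ρ`: each greedy action competes in the maximum of the other
  -- function.
  have h2 := abs_le.1 (hfg' (h + 1) ((τ h.succ).1, πf.act (h + 1) (τ h.succ).1))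
  have h3 := abs_le.1 (hfg' (h + 1) ((τ h.succ).1, πg.act (h + 1) (τ h.succ).1))
  have h4 := hf.greedy (h + 1) (τ h.succ).1 (πg.act (h + 1) (τ h.succ).1)
  have h5 := hg.greedy (h + 1) (τ h.succ).1 (πf.act (h + 1) (τ h.succ).1)
  rw [abs_le]
  constructor <;> linarith

theorem IsGreedyPair.abs_bellErr_sub_le (hr : M.UnitReward) (hf : IsGreedyPair M.H f πf)
    (hg : IsGreedyPair M.H g πg) (hρ : 0 ≤ ρ) (hfg : ∀ h < M.H, ∀ x, |f h x - g h x| ≤ ρ)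
    (π : Policy S A) (h : Fin M.H) : |M.bellErr f π h - M.bellErr g π h| ≤ 2 * ρ := by
  have i1 : Integrable (M.tdError f h) (M.episodeLaw π) :=
    .of_mem_Icc _ _ (hf.measurable_tdError h).aemeasurable
      (.of_forall (hf.tdError_mem_Icc hr h))
  have i2 : Integrable (M.tdError g h) (M.episodeLaw π) :=
    .of_mem_Icc _ _ (hg.measurable_tdError h).aemeasurable
      (.of_forall (hg.tdError_mem_Icc hr h))
  rw [Mdp.bellErr, Mdp.bellErr, ← integral_sub i1 i2]
  exact abs_integral_le_of_abs_le (hf.abs_tdError_sub_le hg hρ hfg h)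

theorem IsGreedyPair.abs_empError_sub_le (hf : IsGreedyPair M.H f πf)
    (hg : IsGreedyPair M.H g πg) (hρ : 0 ≤ ρ) (hfg : ∀ h < M.H, ∀ x, |f h x - g h x| ≤ ρ)
    {n : ℕ} (D : Dataset S A M.H n) (h : Fin M.H) :
    |M.empError f D h - M.empError g D h| ≤ 2 * ρ := by
  have key : M.empError f D h - M.empError g D h =
      1 / (n : ℝ) * ∑ i, (M.tdError f h (D i) - M.tdError g h (D i)) := by
    rw [Finset.sum_sub_distrib, mul_sub]; rfl
  rw [key, abs_mul, abs_of_nonneg (by positivity)]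
  have hs : |∑ i, (M.tdError f h (D i) - M.tdError g h (D i))| ≤ n * (2 * ρ) := by
    refine (Finset.abs_sum_le_sum_abs _ _).trans ?_
    refine (Finset.sum_le_card_nsmul _ _ _ fun i _ =>
      hf.abs_tdError_sub_le hg hρ hfg h (D i)).trans ?_
    simp
  rcases Nat.eq_zero_or_pos n with rfl | hn
  · simpa using hρ
  · have hn' : (0 : ℝ) < n := by exact_mod_cast hn
    rw [one_div, inv_mul_le_iff₀ hn']
    exact hs

end Close

end Olive

namespace Olive

/-! ### Independent sequences -/

/-- Every member of the sequence is `ε`-independent of its predecessors. -/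
def IsIndepSeq {X : Type*} [MeasurableSpace X] (G : Set (X → ℝ)) (ε : ℝ) {n : ℕ}
    (ρ : Fin n → Measure X) : Prop :=
  ∀ i : Fin n, IsIndepOf G ε (ρ i) fun j : Fin i => ρ (j.castLE i.2.le)

theorem IsIndepSeq.snoc {X : Type*} [MeasurableSpace X] {G : Set (X → ℝ)} {ε : ℝ} {n : ℕ}
    {ρ : Fin n → Measure X} (hρ : IsIndepSeq G ε ρ) {ν : Measure X} (hν : IsIndepOf G ε ν ρ) :
    IsIndepSeq G ε (Fin.snoc ρ ν : Fin (n + 1) → Measure X) := by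
  intro i
  induction i using Fin.lastCases with
  | last =>
    rw [Fin.snoc_last]
    have : (fun j : Fin n => (Fin.snoc ρ ν : Fin (n + 1) → Measure X) j.castSucc) = ρ :=
      funext fun j => Fin.snoc_castSucc (α := fun _ => Measure X) ν ρ j
    exact this.symm ▸ hν
  | cast i =>
    rw [Fin.snoc_castSucc]
    have : (fun j : Fin i => (Fin.snoc ρ ν : Fin (n + 1) → Measure X)
        (j.castLE i.2.le).castSucc) = fun j : Fin i => ρ (j.castLE i.2.le) :=
      funext fun j => Fin.snoc_castSucc (α := fun _ => Measure X) ν ρ (j.castLE i.2.le)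
    exact this.symm ▸ hρ i

theorem IsIndepSeq.le_distEluderDim {X : Type*} [MeasurableSpace X] {G : Set (X → ℝ)}
    {D : Set (Measure X)} {ε : ℝ} {n : ℕ} {ρ : Fin n → Measure X} (hρ : IsIndepSeq G ε ρ)
    (hD : ∀ i, ρ i ∈ D) : (n : ℕ∞) ≤ distEluderDim G D ε :=
  le_iSup₂_of_le n ⟨ρ, hD, ε, le_rfl, hρ⟩ le_rfl

theorem distEluderDim_eq_zero {X : Type*} [MeasurableSpace X] {G : Set (X → ℝ)}
    {D : Set (Measure X)} {ε : ℝ} (h : ∀ g ∈ G, ∀ ρ ∈ D, |∫ x, g x ∂ρ| ≤ ε) :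
    distEluderDim G D ε = 0 := by
  refine le_antisymm (iSup₂_le fun n hn => ?_) zero_le
  obtain ⟨ρ, hD, ε', hε', hρ⟩ := hn
  rcases Nat.eq_zero_or_pos n with rfl | hn
  · simp
  · obtain ⟨g, hg, -, hlt⟩ := hρ ⟨0, hn⟩
    linarith [h g hg _ (hD ⟨0, hn⟩)]

/-! ### Histories of accurate runs -/

variable {S A : Type*} [MeasurableSpace S] [MeasurableSpace A] {M : Mdp S A}
  {V : Set (QFun S A)} {pol : QFun S A → Policy S A} {p : Params} {ch : Choices S A M.H p}
  {e : ℝ}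

theorem IsGreedyPair.bellErr_optQ {πs : Policy S A} (hQ : IsGreedyPair M.H M.optQ πs)
    (hr : M.UnitReward) (π : Policy S A) (h : Fin M.H) : M.bellErr M.optQ π h = 0 := by
  rw [hQ.bellErr_eq hr, M.bellman_optQ hr hQ h.2]
  simp

/-- In all phases of the history, the data collected for the elimination give accurate Bellman
errors, and the picked step is one at which the Bellman error exceeds `e`. -/
def Mdp.IsGoodHist (M : Mdp S A) (V : Set (QFun S A)) (pol : QFun S A → Policy S A) (p : Params)
    (ch : Choices S A M.H p) (e : ℝ) : List (PhaseRecord S A M.H p) → Prop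
  | [] => True
  | q :: hist => M.IsGoodHist V pol p ch e hist ∧
      (∀ f ∈ V, |M.empError f q.elimData q.step -
        M.bellErr f (pol (ch.fn hist)) q.step| ≤ p.zElim) ∧
      e < M.bellErr (ch.fn hist) (pol (ch.fn hist)) q.step

theorem Mdp.mem_confSet_cons {q : PhaseRecord S A M.H p} {hist : List (PhaseRecord S A M.H p)}
    {f : QFun S A} : f ∈ M.confSet V p (q :: hist) ↔
      f ∈ M.confSet V p hist ∧ |M.empError f q.elimData q.step| ≤ p.zElim := by
  simp only [Mdp.confSet, List.mem_cons, forall_eq_or_imp, Set.mem_ofPred]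
  tauto

theorem Mdp.IsGoodHist.optQ_mem (hr : M.UnitReward)
    (hV : ∀ f ∈ V, IsGreedyPair M.H f (pol f)) (hQ : M.optQ ∈ V) :
    ∀ {hist : List (PhaseRecord S A M.H p)}, M.IsGoodHist V pol p ch e hist →
      M.optQ ∈ M.confSet V p hist
  | [], _ => ⟨hQ, by simp⟩
  | q :: hist, h => by
    refine Mdp.mem_confSet_cons.2 ⟨optQ_mem hr hV hQ h.1, ?_⟩
    simpa [(hV _ hQ).bellErr_optQ hr] using h.2.1 _ hQ

/-- Sort the phases by the picked step and collect their roll-in laws. Each new law is independent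
of those at the same step, witnessed by the residual of the function executed: it survived, so it is
small on the old laws, and it is large on the new one. The bound on survivors is carried along to
feed the next phase. -/
theorem Mdp.IsGoodHist.exists_indepSeq (hr : M.UnitReward)
    (hV : ∀ f ∈ V, IsGreedyPair M.H f (pol f)) (hQ : M.optQ ∈ V)
    (hch : ch.Valid M V pol) {d : ℕ}
    (hdim : ∀ h : Fin M.H, distEluderDim (M.residuals V h) (M.rollinLaws V pol h) e ≤ d)
    (he : 0 ≤ e) (hd : d * (2 * p.zElim) ^ 2 ≤ e ^ 2)
    {hist : List (PhaseRecord S A M.H p)} (hh : M.IsGoodHist V pol p ch e hist) :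
    ∃ n : Fin M.H → ℕ, ∑ t, n t = hist.length ∧ ∀ t, ∃ ρ : Fin (n t) → Measure (S × A),
      (∀ i, ρ i ∈ M.rollinLaws V pol t) ∧ IsIndepSeq (M.residuals V t) e ρ ∧
        ∀ f ∈ M.confSet V p hist, ∀ i,
          |∫ x, (f t x - M.bellman t (f (t + 1)) x) ∂(ρ i)| ≤ 2 * p.zElim := by
  induction hist with
  | nil => exact ⟨fun _ => 0, by simp, fun t => ⟨Fin.elim0, (·.elim0), (·.elim0), by simp⟩⟩
  | cons q hist ih =>
    obtain ⟨hh, hacc, hlt⟩ := hh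
    obtain ⟨n, hn, hseq⟩ := ih hh
    have hfc := hch.fn_mem hist ⟨_, hh.optQ_mem hr hV hQ⟩
    set f := ch.fn hist
    have hf := hV f hfc.1
    refine ⟨Function.update n q.step (n q.step + 1), ?_, fun t => ?_⟩
    · rw [Finset.sum_update_of_mem (Finset.mem_univ _), ← Finset.erase_eq, List.length_cons, ← hn,
        ← Finset.add_sum_erase _ _ (Finset.mem_univ q.step)]
      ring
    · obtain ⟨ρ, hρ, hind, hsmall⟩ := hseq t
      rcases eq_or_ne t q.step with rfl | ht
      · rw [Function.update_self]
        refine ⟨Fin.snoc ρ (M.rollin (pol f) q.step), fun i => ?_, hind.snoc ?_, ?_⟩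
        · induction i using Fin.lastCases with
          | last => rw [Fin.snoc_last]; exact ⟨f, hfc.1, rfl⟩
          | cast i => rw [Fin.snoc_castSucc]; exact hρ i
        · refine ⟨_, ⟨f, hfc.1, rfl⟩, ?_, ?_⟩
          · refine Real.sqrt_le_iff.2 ⟨he, le_trans ?_ hd⟩
            -- No circularity: the sequence built so far is already independent, so the dimension
            -- bounds its length.
            have hcard : (n q.step : ℝ) ≤ d := by
              exact_mod_cast (hind.le_distEluderDim hρ).trans (hdim q.step)
            refine (Finset.sum_le_card_nsmul _ _ ((2 * p.zElim) ^ 2) fun i _ =>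
              sq_le_sq.2 ((hsmall f hfc i).trans (le_abs_self _))).trans ?_
            rw [Finset.card_univ, Fintype.card_fin, nsmul_eq_mul]
            exact mul_le_mul_of_nonneg_right hcard (sq_nonneg _)
          · rw [← hf.bellErr_eq hr]
            exact hlt.trans_le (le_abs_self _)
        · intro g hg i
          rw [Mdp.mem_confSet_cons] at hg
          induction i using Fin.lastCases with
          | last =>
            rw [Fin.snoc_last, ← (hV g hg.1.1).bellErr_eq hr]
            -- A survivor has empirical error at most `zElim`, which is within `zElim` of its true
            -- error; hence the factor 2.
            have h1 := abs_le.1 (hacc g hg.1.1)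
            have h2 := abs_le.1 hg.2
            rw [abs_le]
            constructor <;> linarith
          | cast i => rw [Fin.snoc_castSucc]; exact hsmall g hg.1 i
      · rw [Function.update_of_ne ht]
        exact ⟨ρ, hρ, hind, fun g hg => hsmall g (Mdp.mem_confSet_cons.1 hg).1⟩

theorem Mdp.IsGoodHist.length_le (hr : M.UnitReward)
    (hV : ∀ f ∈ V, IsGreedyPair M.H f (pol f)) (hQ : M.optQ ∈ V)
    (hch : ch.Valid M V pol) {d : ℕ}
    (hdim : ∀ h : Fin M.H, distEluderDim (M.residuals V h) (M.rollinLaws V pol h) e ≤ d)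
    (he : 0 ≤ e) (hd : d * (2 * p.zElim) ^ 2 ≤ e ^ 2)
    {hist : List (PhaseRecord S A M.H p)} (hh : M.IsGoodHist V pol p ch e hist) :
    hist.length ≤ d * M.H := by
  obtain ⟨n, hn, hseq⟩ := hh.exists_indepSeq hr hV hQ hch hdim he hd
  rw [← hn]
  refine (Finset.sum_le_card_nsmul _ _ d fun t _ => ?_).trans (by simp [mul_comm])
  obtain ⟨ρ, hρ, hind, -⟩ := hseq t
  exact_mod_cast (hind.le_distEluderDim hρ).trans (hdim t)

/-! ### The probability of success -/

/-- Only `G` has to be measurable, so this applies to lower integrals of the non-measurable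
integrands that arbitrary choice rules produce. -/
theorem mul_le_lintegral_of_forall_mem {X : Type*} [MeasurableSpace X] {μ : Measure X}
    {G : Set X} (hG : MeasurableSet G) {F : X → ℝ≥0∞} {a v : ℝ≥0∞} (ha : a ≤ μ G)
    (hF : ∀ x ∈ G, v ≤ F x) : a * v ≤ ∫⁻ x, F x ∂μ :=
  calc a * v ≤ v * μ G := by rw [mul_comm]; gcongr
    _ = ∫⁻ _ in G, v ∂μ := (setLIntegral_const _ _).symm
    _ ≤ ∫⁻ x in G, F x ∂μ := setLIntegral_mono' hG hF
    _ ≤ ∫⁻ x, F x ∂μ := setLIntegral_le_lintegral _ _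

/-- After a good history, accurate data for the test (probability at least `a`) make stopping a
success. Otherwise accurate data for the elimination (probability at least `b`) extend the history
to a good one. Each remaining phase thus costs a factor `a * b`. -/
theorem Mdp.pow_le_oliveProbWithin (hr : M.UnitReward)
    (hV : ∀ f ∈ V, IsGreedyPair M.H f (pol f)) (hQ : M.optQ ∈ V)
    (hch : ch.Valid M V pol) {good : Policy S A → ℕ → ℕ → Prop} {a b : ℝ≥0∞} {t : ℝ} {L : ℕ}
    (ha : a ≤ 1) (hb : b ≤ 1)
    (hact : ∀ f ∈ V, a ≤ M.datasetLaw (pol f) p.nAct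
      (M.accurate (fun _ : Fin M.H => f) id (pol f) t p.nAct))
    (helim : ∀ f ∈ V, ∀ h, ∃ G, MeasurableSet G ∧ b ≤ M.datasetLaw (pol f) p.nElim G ∧
      ∀ D ∈ G, ∀ g ∈ V, |M.empError g D h - M.bellErr g (pol f) h| ≤ p.zElim)
    (he : e + t ≤ p.zAct)
    (hlen : ∀ hist, M.IsGoodHist V pol p ch e hist → hist.length ≤ L)
    (hgood : ∀ hist, M.IsGoodHist V pol p ch e hist →
      ∑ h, M.bellErr (ch.fn hist) (pol (ch.fn hist)) h ≤ M.H * (p.zAct + t) →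
      good (pol (ch.fn hist)) (hist.length + 1)
        ((hist.length + 1) * p.nAct + hist.length * p.nElim)) (m : ℕ) :
    ∀ hist, M.IsGoodHist V pol p ch e hist → hist.length + m = L + 1 →
      (a * b) ^ m ≤ M.oliveProbWithin V pol p ch good m hist := by
  induction m with
  | zero =>
    -- The budget cannot run out: a good history of length `L + 1` does not exist.
    intro hist hh hm
    have := hlen hist hh
    omega
  | succ m ih =>
    intro hist hh hm
    have hne : (M.confSet V p hist).Nonempty := ⟨_, hh.optQ_mem hr hV hQ⟩
    have hfV : ch.fn hist ∈ V := (hch.fn_mem hist hne).1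
    rw [Mdp.oliveProbWithin, if_pos hne, pow_succ', mul_assoc]
    refine mul_le_lintegral_of_forall_mem
      (measurableSet_accurate (fun _ => hV _ hfV) id _ t _) (hact _ hfV) fun D hD => ?_
    have hD' (h : Fin M.H) : -t ≤ M.empError (ch.fn hist) D h -
          M.bellErr (ch.fn hist) (pol (ch.fn hist)) h ∧
        M.empError (ch.fn hist) D h - M.bellErr (ch.fn hist) (pol (ch.fn hist)) h ≤ t :=
      abs_le.1 (hD h)
    split_ifs with hterm hg
    · exact mul_le_one' hb (pow_le_one' (mul_le_one' ha hb) m)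
    · refine absurd (hgood hist hh ?_) hg
      have : ∑ h, M.bellErr (ch.fn hist) (pol (ch.fn hist)) h ≤
          ∑ h, (M.empError (ch.fn hist) D h + t) :=
        Finset.sum_le_sum fun h _ => by linarith [(hD' h).1]
      rw [Finset.sum_add_distrib] at this
      simp only [Finset.sum_const, Finset.card_univ, Fintype.card_fin, nsmul_eq_mul] at this
      linarith
    · obtain ⟨G, hGm, hGb, hG⟩ := helim _ hfV (ch.step hist D)
      refine mul_le_lintegral_of_forall_mem hGm hGb fun E hE => ih _ ⟨hh, hG E hE, ?_⟩ ?_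
      · have hex : ∃ h, p.zAct < M.empError (ch.fn hist) D h := by
          by_contra! hcon
          refine hterm ((Finset.sum_le_card_nsmul _ _ _ fun h _ => hcon h).trans ?_)
          simp
        have h1 := hch.step_gt hist D hex
        have h2 := (hD' (ch.step hist D)).2
        change e < M.bellErr (ch.fn hist) (pol (ch.fn hist)) (ch.step hist D)
        linarith
      · rw [List.length_cons]; omega

end Olive

namespace Olive

/-! ### Numerical estimates -/

section Numerics

variable {H d : ℕ} {ε δ : ℝ}

theorem lt_logFactor (hx : 2 ≤ H * d / (δ * ε)) : 0.69 < logFactor H d ε δ :=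
  (by linarith [Real.log_two_gt_d9] : (0.69 : ℝ) < Real.log 2).trans_le
    (Real.log_le_log two_pos hx)

theorem exp_neg_mul_logFactor (hx : 2 ≤ H * d / (δ * ε)) (k : ℕ) :
    Real.exp (-(k * logFactor H d ε δ)) = ((H * d / (δ * ε)) ^ k)⁻¹ := by
  rw [Real.exp_neg, Real.exp_nat_mul, logFactor, Real.exp_log (two_pos.trans_le hx)]

theorem act_failure_le (hε : 0 < ε) (hε1 : ε ≤ 1) (hδ : 0 < δ) (hδ1 : δ ≤ 1) (hH : 1 ≤ H)
    (hd : 1 ≤ d) (hx : 2 ≤ H * d / (δ * ε)) {n : ℝ}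
    (hn : 1000 * H ^ 2 * logFactor H d ε δ / ε ^ 2 ≤ n) :
    H * (2 * Real.exp (-(2 * n * (ε / (2 * H)) ^ 2 / 9))) ≤ δ / (4 * (H * d)) := by
  have hH' : (1 : ℝ) ≤ H := by exact_mod_cast hH
  have hd' : (1 : ℝ) ≤ d := by exact_mod_cast hd
  have hι := lt_logFactor hx
  have hexp := exp_neg_mul_logFactor hx 5
  set ι := logFactor H d ε δ
  set x := H * d / (δ * ε) with hxdef
  have hy : (H : ℝ) * d = x * (δ * ε) := by rw [hxdef]; field_simp
  -- Of the five powers of `x`, two pay for `H * H * d` through `H * d = x * (δ * ε)`, and three pay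
  -- for the factor 8 through `2 ≤ x`.
  have h1 : 5 * ι ≤ 2 * n * (ε / (2 * H)) ^ 2 / 9 :=
    calc 5 * ι ≤ 2 * (1000 * H ^ 2 * ι / ε ^ 2) * (ε / (2 * H)) ^ 2 / 9 := by
          field_simp; linarith
      _ ≤ _ := by gcongr
  have h2 : Real.exp (-(2 * n * (ε / (2 * H)) ^ 2 / 9)) ≤ (x ^ 5)⁻¹ := by
    rw [← hexp]
    exact Real.exp_le_exp.2 (neg_le_neg (by exact_mod_cast h1))
  have hx0 : 0 < x := by linarith
  refine (mul_le_mul_of_nonneg_left (mul_le_mul_of_nonneg_left h2 two_pos.le)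
    (by positivity)).trans ?_
  have h0 : H * (2 * (x ^ 5)⁻¹) = 2 * H / x ^ 5 := by field_simp
  rw [h0, div_le_div_iff₀ (by positivity) (by positivity)]
  have h3 : (H : ℝ) * H * d ≤ (x * (δ * ε)) ^ 2 := by
    rw [← hy]; nlinarith [mul_nonneg (by positivity : (0:ℝ) ≤ H * H * d) (sub_nonneg.2 hd')]
  have h4 : (x * (δ * ε)) ^ 2 ≤ x ^ 2 * δ := by
    have : (δ * ε) ^ 2 ≤ δ := by
      calc (δ * ε) ^ 2 ≤ (δ * 1) ^ 2 := by gcongr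
        _ ≤ δ := by nlinarith
    rw [mul_pow]; gcongr
  have h5 : 8 * (x ^ 2 * δ) ≤ δ * x ^ 5 := by
    have : (2 : ℝ) ^ 3 ≤ x ^ 3 := by gcongr
    nlinarith [mul_nonneg (mul_pos (pow_pos hx0 2) hδ).le (sub_nonneg.2 this)]
  linarith

theorem elim_failure_le (hε : 0 < ε) (hε1 : ε ≤ 1) (hδ : 0 < δ) (hH : 1 ≤ H)
    (hd : 1 ≤ d) (hx : 2 ≤ H * d / (δ * ε)) {N : ℕ} (hN : 2 ≤ N) {n : ℝ}
    (hn : 1000 * H ^ 2 * d * Real.log N * logFactor H d ε δ / ε ^ 2 ≤ n) :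
    N * (2 * Real.exp (-(2 * n * (ε / (4 * H * √d)) ^ 2 / 9))) ≤ δ / (4 * (H * d)) := by
  have hH' : (1 : ℝ) ≤ H := by exact_mod_cast hH
  have hd' : (1 : ℝ) ≤ d := by exact_mod_cast hd
  have hN' : (2 : ℝ) ≤ N := by exact_mod_cast hN
  have hι := lt_logFactor hx
  have hexp := exp_neg_mul_logFactor hx 4
  have hlN : 0.69 < Real.log N :=
    (by linarith [Real.log_two_gt_d9] : (0.69 : ℝ) < Real.log 2).trans_le
      (Real.log_le_log two_pos hN')
  set ι := logFactor H d ε δ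
  set l := Real.log N
  set x := H * d / (δ * ε) with hxdef
  have hy : (H : ℝ) * d = x * (δ * ε) := by rw [hxdef]; field_simp
  -- The summand `l` cancels the size `N` of the union bound; of the four powers of `x`, one pays
  -- for `H * d` and three for the factor 8. The product `l * ι` dominates the sum because both
  -- factors exceed 0.69.
  have h1 : l + 4 * ι ≤ 2 * n * (ε / (4 * H * √d)) ^ 2 / 9 :=
    calc l + 4 * ι ≤ 2 * (1000 * H ^ 2 * d * l * ι / ε ^ 2) * (ε / (4 * H * √d)) ^ 2 / 9 := by
          rw [div_pow, mul_pow, Real.sq_sqrt (by positivity)]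
          field_simp
          nlinarith
      _ ≤ _ := by gcongr
  have h2 : Real.exp (-(2 * n * (ε / (4 * H * √d)) ^ 2 / 9)) ≤ (N : ℝ)⁻¹ * (x ^ 4)⁻¹ := by
    rw [← hexp, ← Real.exp_log (by linarith : (0 : ℝ) < N), ← Real.exp_neg, ← Real.exp_add]
    refine Real.exp_le_exp.2 ?_
    push_cast
    linarith
  have hx0 : 0 < x := by linarith
  refine (mul_le_mul_of_nonneg_left (mul_le_mul_of_nonneg_left h2 two_pos.le)
    (by positivity)).trans ?_
  have h3 : N * (2 * ((N : ℝ)⁻¹ * (x ^ 4)⁻¹)) = 2 / x ^ 4 := by field_simp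
  rw [h3, div_le_div_iff₀ (by positivity) (by positivity), hy]
  have h5 : 8 * (x * δ) ≤ δ * x ^ 4 := by
    have : (2 : ℝ) ^ 3 ≤ x ^ 3 := by gcongr
    nlinarith [mul_nonneg (mul_pos hx0 hδ).le (sub_nonneg.2 this)]
  have h6 : x * (δ * ε) ≤ x * δ := by
    gcongr
    exact mul_le_of_le_one_right hδ.le hε1
  linarith

theorem episodes_le (hε : 0 < ε) (hε1 : ε ≤ 1) (hH : 1 ≤ H) (hd : 1 ≤ d)
    (hx : 2 ≤ H * d / (δ * ε)) {N : ℕ} (hN : 2 ≤ N) {k : ℕ} (hk : k ≤ d * H) :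
    (((k + 1) * (params 1000 H d N ε δ).nAct + k * (params 1000 H d N ε δ).nElim : ℕ) : ℝ) ≤
      6000 * (H ^ 3 * d ^ 2 * Real.log N * logFactor H d ε δ / ε ^ 2) := by
  have hH' : (1 : ℝ) ≤ H := by exact_mod_cast hH
  have hd' : (1 : ℝ) ≤ d := by exact_mod_cast hd
  have hN' : (2 : ℝ) ≤ N := by exact_mod_cast hN
  have hk' : (k : ℝ) ≤ d * H := by exact_mod_cast hk
  have hι := lt_logFactor hx
  have hlN : 0.69 < Real.log N :=
    (by linarith [Real.log_two_gt_d9] : (0.69 : ℝ) < Real.log 2).trans_le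
      (Real.log_le_log two_pos hN')
  have hact := (Nat.ceil_lt_add_one (a := 1000 * H ^ 2 * logFactor H d ε δ / ε ^ 2)
    (by positivity)).le
  have helim := (Nat.ceil_lt_add_one
    (a := 1000 * H ^ 2 * d * Real.log N * logFactor H d ε δ / ε ^ 2) (by positivity)).le
  change ((params 1000 H d N ε δ).nAct : ℝ) ≤ _ at hact
  change ((params 1000 H d N ε δ).nElim : ℝ) ≤ _ at helim
  have hA0 : (0 : ℝ) ≤ (params 1000 H d N ε δ).nAct := Nat.cast_nonneg _
  have hE0 : (0 : ℝ) ≤ (params 1000 H d N ε δ).nElim := Nat.cast_nonneg _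
  push_cast
  generalize ((params 1000 H d N ε δ).nAct : ℝ) = nA at *
  generalize ((params 1000 H d N ε δ).nElim : ℝ) = nE at *
  set ι := logFactor H d ε δ
  set l := Real.log N
  obtain ⟨U, hU⟩ : ∃ U, U = H ^ 2 * ι / ε ^ 2 := ⟨_, rfl⟩
  have h1 : ι ≤ U := by
    rw [hU, le_div_iff₀ (by positivity), mul_comm]
    exact mul_le_mul_of_nonneg_right ((pow_le_one₀ hε.le hε1).trans (one_le_pow₀ hH'))
      (by linarith)
  have hl : 0.69 ≤ d * l := by nlinarith
  -- Termination samples are charged to the elimination term `W = U * (d * l)`. As `W` is bounded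
  -- below, `4 * W` also absorbs the 1 lost in each rounding.
  have h2 : U ≤ 2 * (U * (d * l)) := by nlinarith
  have e1 : 1000 * H ^ 2 * ι / ε ^ 2 = 1000 * U := by rw [hU]; ring
  have e2 : 1000 * H ^ 2 * d * l * ι / ε ^ 2 = 1000 * (U * (d * l)) := by rw [hU]; ring
  have e3 : H ^ 3 * d ^ 2 * l * ι / ε ^ 2 = (d * H) * (U * (d * l)) := by rw [hU]; ring
  rw [e1] at hact
  rw [e2] at helim
  rw [e3]
  set W := U * (d * l)
  have hdH : (1 : ℝ) ≤ d * H := by nlinarith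
  calc (k + 1) * nA + k * nE ≤ (d * H + d * H) * (2004 * W) + d * H * (1004 * W) := by
        gcongr
        · linarith
        · linarith
    _ ≤ 6000 * (d * H * W) := by
        have : 0 ≤ d * H * W := by
          have : 0 ≤ W := by linarith
          positivity
        linarith

theorem ofReal_le_pow {α β : ℝ} (hα : 0 ≤ α) (hβ : 0 ≤ β) (h1 : α + β ≤ 1)
    (m : ℕ) (hm : m * (α + β) ≤ δ) :
    ENNReal.ofReal (1 - δ) ≤ (ENNReal.ofReal (1 - α) * ENNReal.ofReal (1 - β)) ^ m := by
  rw [← ENNReal.ofReal_mul (by linarith), ← ENNReal.ofReal_pow (by nlinarith)]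
  refine ENNReal.ofReal_le_ofReal ?_
  calc 1 - δ ≤ 1 + m * (-(α + β)) := by linarith
    _ ≤ (1 + -(α + β)) ^ m := one_add_mul_le_pow (by linarith) m
    _ ≤ ((1 - α) * (1 - β)) ^ m := by
        exact pow_le_pow_left₀ (by linarith) (by nlinarith) m

end Numerics

end Olive

/-! ### Covers of the function class -/

namespace Olive

variable {S A : Type*} [MeasurableSpace S] [MeasurableSpace A] {M : Mdp S A}
  {V : Set (QFun S A)} {pol : QFun S A → Policy S A} {ε : ℝ} {d N : ℕ}

/-- A class of positive Bellman Eluder dimension cannot be covered by one of its members at a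
scale which is small compared to the residuals that the dimension sees. -/
theorem two_le_of_coveringNumber_eq (hr : M.UnitReward)
    (hV : ∀ f ∈ V, IsGreedyPair M.H f (pol f)) (hQ : M.optQ ∈ V) {ρ e : ℝ} (hρ : 0 ≤ ρ)
    (hρe : 4 * ρ ≤ e) (hd : 1 ≤ M.bellmanEluderDim V pol e)
    (hN : coveringNumber M.H V ρ = N) : 2 ≤ N := by
  by_contra! hlt
  obtain ⟨V₀, hsub, hcard, hcov⟩ := exists_cover hN
  have hss : V₀.Subsingleton := Set.encard_le_one_iff_subsingleton.1
    (hcard.trans (by exact_mod_cast Nat.lt_succ_iff.1 hlt))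
  -- A single centre lies within `ρ` of `M.optQ` too, so every `f` has errors within `2 * ρ + 2 * ρ`
  -- of zero.
  obtain ⟨g, hg, hgQ⟩ := hcov _ hQ
  have hzero : M.bellmanEluderDim V pol e = 0 := by
    refine le_antisymm (iSup_le fun h => (distEluderDim_eq_zero ?_).le) zero_le
    rintro _ ⟨f, hf, rfl⟩ _ ⟨f', hf', rfl⟩
    have hE := (hV f hf).bellErr_eq hr (pol f') h
    rw [Mdp.rollin] at hE
    rw [← hE]
    obtain ⟨g', hg', hgf⟩ := hcov f hf
    obtain rfl := hss hg hg'
    have h1 := abs_le.1 ((hV f hf).abs_bellErr_sub_le hr (hV g (hsub hg)) hρ hgf (pol f') h)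
    have h2 := abs_le.1 ((hV _ hQ).abs_bellErr_sub_le hr (hV g (hsub hg)) hρ hgQ (pol f') h)
    rw [(hV _ hQ).bellErr_optQ hr] at h2
    rw [abs_le]
    constructor <;> linarith
  rw [hzero] at hd
  exact absurd hd (by norm_num)

/-- Uniform accuracy of the empirical Bellman errors over a class with a finite cover. -/
theorem exists_uniformly_accurate (hr : M.UnitReward)
    (hV : ∀ f ∈ V, IsGreedyPair M.H f (pol f)) {ρ t : ℝ} (hρ : 0 ≤ ρ) (ht : 0 ≤ t)
    (hN : coveringNumber M.H V ρ = N) (π : Policy S A) (h : Fin M.H) (n : ℕ) :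
    ∃ G : Set (Dataset S A M.H n), MeasurableSet G ∧
      ENNReal.ofReal (1 - N * (2 * Real.exp (-(2 * n * t ^ 2 / 9)))) ≤ M.datasetLaw π n G ∧
      ∀ D ∈ G, ∀ g ∈ V, |M.empError g D h - M.bellErr g π h| ≤ t + 4 * ρ := by
  obtain ⟨V₀, hsub, hcard, hcov⟩ := exists_cover hN
  have hfin : V₀.Finite := Set.finite_of_encard_le_coe hcard
  have := hfin.fintype
  have hcard' : (Fintype.card V₀ : ℝ) ≤ N := by
    rw [← Set.toFinset_card, ← Set.ncard_eq_toFinset_card']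
    exact_mod_cast hfin.cast_ncard_eq.le.trans hcard
  have hV₀ (f : V₀) : IsGreedyPair M.H f.1 (pol f) := hV f (hsub f.2)
  refine ⟨M.accurate (fun f : V₀ => f.1) (fun _ => h) π t n,
    measurableSet_accurate hV₀ _ _ _ _, ?_, fun D hD g hg => ?_⟩
  · refine le_trans (ENNReal.ofReal_le_ofReal ?_) (le_datasetLaw_accurate hr hV₀ _ π ht n)
    gcongr
  · obtain ⟨g₀, hg₀, hgg⟩ := hcov g hg
    -- Passing from `g` to its centre costs `2 * ρ` in the true error and again `2 * ρ` in the
    -- empirical one.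
    have h1 := abs_le.1 (hD ⟨g₀, hg₀⟩)
    have h2 := abs_le.1 ((hV g hg).abs_bellErr_sub_le hr (hV₀ ⟨g₀, hg₀⟩) hρ hgg π h)
    have h3 := abs_le.1 ((hV g hg).abs_empError_sub_le (hV₀ ⟨g₀, hg₀⟩) hρ hgg D h)
    dsimp only at h1 h2 h3
    rw [abs_le]
    constructor <;> linarith

end Olive

/-! ### The guarantee of the algorithm -/

theorem mainTheorem3 :
    ∃ c C : ℝ, 0 < c ∧ 0 < C ∧
      ∀ (S A : Type*) [MeasurableSpace S] [MeasurableSpace A] (M : Olive.Mdp S A)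
        (F : ℕ → Set (S × A → ℝ)) (pol : Olive.QFun S A → Olive.Policy S A)
        (ε δ : ℝ) (d N : ℕ),
        M.NormalizedReward →
        (∀ h < M.H, ∀ g ∈ F h, Measurable g ∧ ∀ x, 0 ≤ g x ∧ g x ≤ 1) →
        Olive.IsGreedy M.H (Olive.prodClass M.H F) pol →
        (∀ h < M.H, M.optQ h ∈ F h) →
        0 < ε → ε ≤ 1 → 0 < δ → δ ≤ 1 →
        M.bellmanEluderDim (Olive.prodClass M.H F) pol (ε / M.H) = d →
        1 ≤ d →
        2 ≤ M.H * d / (δ * ε) →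
        Olive.coveringNumber M.H (Olive.prodClass M.H F) (ε / (16 * M.H * √d)) = N →
        ∀ ch : Olive.Choices S A M.H (Olive.params c M.H d N ε δ),
          ch.Valid M (Olive.prodClass M.H F) pol →
          ENNReal.ofReal (1 - δ) ≤
            M.oliveProb (Olive.prodClass M.H F) pol (Olive.params c M.H d N ε δ) ch
              fun π k n =>
                k ≤ d * M.H + 1 ∧ M.IsNearOptimal (4 * ε) π ∧
                  (n : ℝ) ≤ C * (M.H ^ 3 * d ^ 2 * Real.log N *
                    Olive.logFactor M.H d ε δ / ε ^ 2) := by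
  -- Both constants are generous: the first makes each data set fail with probability at most `δ /
  -- (4 * (M.H * d))`, the second covers the episode count.
  refine ⟨1000, 6000, by norm_num, by norm_num, ?_⟩
  intro S A _ _ M F pol ε δ d N hnorm hF hpol hreal hε hε1 hδ hδ1 hdim hd hx hN ch hch
  have hr : M.UnitReward := hnorm.1
  set V := Olive.prodClass M.H F
  have hV : ∀ f ∈ V, Olive.IsGreedyPair M.H f (pol f) := fun f hf =>
    Olive.IsGreedyPair.of_mem hF hpol hf
  have hQ : M.optQ ∈ V := ⟨hreal, fun h hh => M.optQ_of_le hh⟩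
  have hH : 1 ≤ M.H := by
    by_contra! h0
    obtain h0 : M.H = 0 := by omega
    norm_num [h0] at hx
  have hH' : (1 : ℝ) ≤ M.H := by exact_mod_cast hH
  have hd' : (1 : ℝ) ≤ d := by exact_mod_cast hd
  have hsq : (1 : ℝ) ≤ √d := Real.one_le_sqrt.2 hd'
  have hHd : (1 : ℝ) ≤ M.H * d := by nlinarith
  have hN2 : 2 ≤ N := by
    refine Olive.two_le_of_coveringNumber_eq hr hV hQ (by positivity) ?_
      (by rw [hdim]; exact_mod_cast hd) hN
    rw [← mul_div_assoc, div_le_div_iff₀ (by positivity) (by positivity)]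
    have : ε * M.H * 1 ≤ ε * M.H * √d := by gcongr
    nlinarith [mul_pos hε (one_pos.trans_le hH')]
  set α := M.H * (2 * Real.exp (-(2 * (Olive.params 1000 M.H d N ε δ).nAct *
    (ε / (2 * M.H)) ^ 2 / 9))) with hα
  set β := N * (2 * Real.exp (-(2 * (Olive.params 1000 M.H d N ε δ).nElim *
    (ε / (4 * M.H * √d)) ^ 2 / 9))) with hβ
  have hαle : α ≤ δ / (4 * (M.H * d)) :=
    Olive.act_failure_le hε hε1 hδ hδ1 hH hd hx (Nat.le_ceil _)
  have hβle : β ≤ δ / (4 * (M.H * d)) :=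
    Olive.elim_failure_le hε hε1 hδ hH hd hx hN2 (Nat.le_ceil _)
  have hα0 : 0 ≤ α := by positivity
  have hβ0 : 0 ≤ β := by positivity
  -- There are at most `d * M.H + 1 ≤ 2 * (M.H * d)` phases, with two data sets each.
  have hsum : 2 * (M.H * d) * (α + β) ≤ δ := by
    have : 2 * (M.H * d) * (α + β) ≤
        2 * (M.H * d) * (δ / (4 * (M.H * d)) + δ / (4 * (M.H * d))) := by gcongr
    refine this.trans_eq ?_
    field_simp
    norm_num
  refine (Olive.ofReal_le_pow hα0 hβ0 (by nlinarith) (d * M.H + 1) ?_).trans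
    (le_trans ?_ (le_iSup _ (d * M.H + 1)))
  · push_cast
    refine le_trans ?_ hsum
    gcongr
    linarith [mul_comm (d : ℝ) M.H]
  have hdim' (h : Fin M.H) :
      Olive.distEluderDim (M.residuals V h) (M.rollinLaws V pol h) (ε / M.H) ≤ d :=
    (le_iSup (fun h : Fin M.H =>
      Olive.distEluderDim (M.residuals V h) (M.rollinLaws V pol h) (ε / M.H)) h).trans hdim.le
  have hlen (hist) (hh : M.IsGoodHist V pol _ ch (ε / M.H) hist) : hist.length ≤ d * M.H := by
    -- The threshold is tuned so that `d * (2 * zElim) ^ 2` equals `(ε / M.H) ^ 2`.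
    refine hh.length_le hr hV hQ hch hdim' (by positivity) (le_of_eq ?_)
    simp only [Olive.params]
    rw [← mul_div_assoc, div_pow, mul_pow, mul_pow, mul_pow, Real.sq_sqrt (by positivity)]
    field_simp
  refine Olive.Mdp.pow_le_oliveProbWithin (t := ε / (2 * M.H)) (L := d * M.H) hr hV hQ hch
    (ENNReal.ofReal_le_one.2 (by linarith)) (ENNReal.ofReal_le_one.2 (by linarith))
    ?_ ?_ ?_ hlen ?_ (d * M.H + 1) [] trivial (by simp)
  · intro f hf
    have := Olive.le_datasetLaw_accurate hr (fun _ : Fin M.H => hV f hf) id (pol f)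
      (t := ε / (2 * M.H)) (by positivity) (Olive.params 1000 M.H d N ε δ).nAct
    rwa [Fintype.card_fin] at this
  · intro f hf h
    -- Half of `zElim` is left to sampling and the other half, four times the covering radius, to
    -- discretisation.
    obtain ⟨G, hG, hGb, hacc⟩ := Olive.exists_uniformly_accurate hr hV (t := ε / (4 * M.H * √d))
      (by positivity) (by positivity) hN (pol f) h (Olive.params 1000 M.H d N ε δ).nElim
    refine ⟨G, hG, hGb, fun D hD g hg => (hacc D hD g hg).trans_eq ?_⟩
    simp only [Olive.params]
    field_simp
    norm_num
  · simp only [Olive.params]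
    rw [div_add_div _ _ (by positivity) (by positivity),
      div_le_div_iff₀ (by positivity) (by positivity)]
    nlinarith [mul_pos hε (mul_pos (one_pos.trans_le hH')
      (mul_pos (one_pos.trans_le hH') (one_pos.trans_le hH')))]
  · intro hist hh hle
    refine ⟨Nat.succ_le_succ (hlen hist hh), ?_, Olive.episodes_le hε hε1 hH hd hx hN2
      (hlen hist hh)⟩
    have hQc := hh.optQ_mem hr hV hQ
    have hf := hV _ (hch.fn_mem hist ⟨_, hQc⟩).1
    have h1 := hch.fn_max hist _ hQc
    have h2 := M.optV_le hr (hV _ hQ) 0 M.init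
    rw [hf.sum_bellErr hr] at hle
    -- The left side is `5 / 2 * ε`.
    have h3 : M.H * ((Olive.params 1000 M.H d N ε δ).zAct + ε / (2 * M.H)) ≤ 4 * ε := by
      simp only [Olive.params]
      field_simp
      norm_num
    rw [Olive.Mdp.IsNearOptimal]
    linarith
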